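/- Let $p$ be an odd prime, let $G$ be a finite group, let $P$ be a Sylow $p$-subgroup of $G$, and let $\mathcal F = \mathcal F_P(G)$ be the fusion system of $G$ on $P$, i.e. the category whose objects are the subgroups of $P$ and whose morphisms $Q \to R$ are the maps $x \mapsto g^{-1}xg$ with $g \in G$, $g^{-1}Qg \le R$. Then $\mathcal F$ is $Qd(p)$-free if and only if $G$ does not involve $Qd(p)$. Here $Qd(p) = \mathbb F_p^2 \rtimes SL_2(p)$ with respect to the natural action, and a group involves $Qd(p)$ if it has subgroups $K \trianglelefteq H$ with $H/K \cong Qd(p)$. A subgroup $Q \le P$ is fully $\mathcal F$-normalised if $|N_P(Q)| \ge |N_P(Q\varphi)|$, and $\mathcal F$-centric if $C_P(Q\varphi) \le Q\varphi$, for every morphism $\varphi$ of $\mathcal F$ with domain $Q$. The normaliser $\mathcal N_{\mathcal F}(Q)$ is the fusion system on $N_P(Q)$ whose morphisms $R \to T$ are those morphisms of $\mathcal F$ that extend to an $\mathcal F$-morphism $RQ \to TQ$ restricting to an $\mathcal F$-automorphism of $Q$. A model of a fusion system $\mathcal E$ on a finite $p$-group $S$ is a finite group $L$ with Sylow $p$-subgroup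 $S$ such that $C_L(O_p(L)) \le O_p(L)$, $O_{p'}(L) = 1$ and $\mathcal E = \mathcal F_S(L)$. Finally, $\mathcal F$ is $Qd(p)$-free if, for every $\mathcal F$-centric and fully $\mathcal F$-normalised subgroup $Q$ of $P$, no model of $\mathcal N_{\mathcal F}(Q)$ involves $Qd(p)$. -/

import Mathlib

universe u

/-- A finite group `G` involves `X` if some section `H / K` of `G` is isomorphic to `X`. -/
def Involves (G X : Type*) [Group G] [Group X] : Prop :=
  ∃ (H : Subgroup G) (K : Subgroup H) (_ : K.Normal), Nonempty (H ⧸ K ≃* X)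

/-- The natural action of `SL₂(p)` on the (multiplicatively written) vector space `𝔽_p²`. -/
def Qd.action (p : ℕ) :
    Matrix.SpecialLinearGroup (Fin 2) (ZMod p) →* MulAut (Multiplicative (Fin 2 → ZMod p)) where
  toFun A := AddEquiv.toMultiplicative (Matrix.SpecialLinearGroup.toLin' A).toAddEquiv
  map_one' := by ext; simp
  map_mul' A B := by ext; simp

/-- The group `Qd(p) = 𝔽_p² ⋊ SL₂(p)`. -/
abbrev Qd (p : ℕ) : Type :=
  Multiplicative (Fin 2 → ZMod p) ⋊[Qd.action p] Matrix.SpecialLinearGroup (Fin 2) (ZMod p)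

/-- `O_p(L)`: the largest normal `p`-subgroup of the finite group `L`. -/
def pCore (p : ℕ) (L : Type*) [Group L] : Subgroup L :=
  sSup {N : Subgroup L | N.Normal ∧ IsPGroup p N}

/-- `O_{p'}(L)`: the largest normal subgroup of order prime to `p` of the finite group `L`. -/
def pPrimeCore (p : ℕ) (L : Type*) [Group L] : Subgroup L :=
  sSup {N : Subgroup L | N.Normal ∧ (Nat.card N).Coprime p}

/-- A fusion system on the group `P`: a category whose objects are the subgroups of `P` and whose
morphisms are injective group homomorphisms, containing all conjugations by elements of `P`, and
such that the isomorphism onto the image of a morphism and its inverse are again morphisms.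
(The saturation axioms enter none of the notions defined below; they hold automatically for the
fusion system of a finite group on a Sylow subgroup.) -/
@[ext]
structure FusionSystem (P : Type u) [Group P] where
  /-- the morphisms from `Q` to `R` -/
  Hom : ∀ Q R : Subgroup P, Set (Q →* R)
  injective : ∀ {Q R : Subgroup P} {φ : Q →* R}, φ ∈ Hom Q R → Function.Injective φ
  id_mem : ∀ Q : Subgroup P, MonoidHom.id Q ∈ Hom Q Q
  comp_mem : ∀ {Q R T : Subgroup P} {φ : Q →* R} {ψ : R →* T},
    φ ∈ Hom Q R → ψ ∈ Hom R T → ψ.comp φ ∈ Hom Q T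
  conj_mem : ∀ {Q R : Subgroup P} (g : P) (φ : Q →* R),
    (∀ x : Q, (φ x : P) = g⁻¹ * x * g) → φ ∈ Hom Q R
  /-- `S` is here necessarily the image of `φ`, and `e` is `φ` with restricted codomain. -/
  iso_mem : ∀ {Q R S : Subgroup P} {φ : Q →* R}, φ ∈ Hom Q R → ∀ e : Q ≃* S,
    (∀ x : Q, (e x : P) = φ x) → e.toMonoidHom ∈ Hom Q S ∧ e.symm.toMonoidHom ∈ Hom S Q

namespace FusionSystem

/-- The fusion system on `P` of a group `G` into which `P` is embedded by `ι`: the morphisms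
`Q → R` are the maps induced by conjugations `x ↦ g⁻¹ x g` in `G`. -/
def ofEmbedding {P : Type u} [Group P] {G : Type*} [Group G] (ι : P →* G)
    (hι : Function.Injective ι) : FusionSystem P where
  Hom Q R := {φ | ∃ g : G, ∀ x : Q, ι (φ x) = g⁻¹ * ι x * g}
  injective := by
    rintro Q R φ ⟨g, hg⟩ x y hxy
    have h := hg x
    rw [hxy, hg y] at h
    exact Subtype.ext (hι (by simpa using h.symm))
  id_mem Q := ⟨1, by simp⟩
  comp_mem := by
    rintro Q R T φ ψ ⟨g, hg⟩ ⟨k, hk⟩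
    exact ⟨g * k, fun x => by simp [hg, hk, mul_assoc]⟩
  conj_mem g φ h := ⟨ι g, fun x => by simp [h]⟩
  iso_mem := by
    rintro Q R S φ ⟨g, hg⟩ e he
    refine ⟨⟨g, fun x => by simp [he, hg]⟩, ⟨g⁻¹, fun y => ?_⟩⟩
    have h := hg (e.symm y)
    rw [← he] at h
    simp only [MulEquiv.apply_symm_apply] at h
    simp [h, mul_assoc]

/-- `F_P(G)`, the fusion system of the group `G` on its subgroup `P`. -/
def ofGroup {G : Type u} [Group G] (P : Subgroup G) : FusionSystem P :=
  ofEmbedding P.subtype P.subtype_injective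

variable {P : Type u} [Group P]

/-- The image of a homomorphism between subgroups of `P`, as a subgroup of `P`. -/
def image {Q R : Subgroup P} (φ : Q →* R) : Subgroup P := φ.range.map R.subtype

/-- `Q` is fully `F`-normalised. -/
def IsFullyNormalised (F : FusionSystem P) (Q : Subgroup P) : Prop :=
  ∀ (R : Subgroup P), ∀ φ ∈ F.Hom Q R,
    Nat.card (Subgroup.normalizer (image φ : Set P)) ≤ Nat.card (Subgroup.normalizer (Q : Set P))

/-- `Q` is `F`-centric. -/
def IsCentric (F : FusionSystem P) (Q : Subgroup P) : Prop :=
  ∀ (R : Subgroup P), ∀ φ ∈ F.Hom Q R,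
    Subgroup.centralizer (image φ : Set P) ≤ image φ

/-- For a subgroup `R` of `N_P(Q)`, the subgroup `RQ` of `P` (as `R` normalises `Q`, the join is
the product). -/
def mulNorm (Q : Subgroup P) (R : Subgroup (Subgroup.normalizer (Q : Set P))) : Subgroup P :=
  R.map (Subgroup.normalizer (Q : Set P)).subtype ⊔ Q

theorem mulNorm_left {Q : Subgroup P} {R : Subgroup (Subgroup.normalizer (Q : Set P))} (x : R) :
    ((x : Subgroup.normalizer (Q : Set P)) : P) ∈ mulNorm Q R :=
  Subgroup.mem_sup_left ⟨x, x.2, rfl⟩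

theorem mulNorm_right {Q : Subgroup P} {R : Subgroup (Subgroup.normalizer (Q : Set P))} (x : Q) :
    (x : P) ∈ mulNorm Q R :=
  Subgroup.mem_sup_right x.2

/-- `φ' : RQ → TQ` is a morphism of `F` which extends `φ : R → T` and restricts to an
`F`-automorphism of `Q`. (In particular `φ` is then itself a morphism of `F`.) -/
def IsExtension (F : FusionSystem P) (Q : Subgroup P)
    {R T : Subgroup (Subgroup.normalizer (Q : Set P))} (φ : R →* T)
    (φ' : mulNorm Q R →* mulNorm Q T) : Prop :=
  φ' ∈ F.Hom (mulNorm Q R) (mulNorm Q T) ∧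
  (∀ x : R, (φ' ⟨x, mulNorm_left x⟩ : P) = (φ x : Subgroup.normalizer (Q : Set P))) ∧
  ∃ α : Q ≃* Q, α.toMonoidHom ∈ F.Hom Q Q ∧
    ∀ x : Q, (φ' ⟨x, mulNorm_right x⟩ : P) = α x

theorem image_extension {F : FusionSystem P} {Q : Subgroup P}
    {R T S : Subgroup (Subgroup.normalizer (Q : Set P))} {φ : R →* T}
    {φ' : mulNorm Q R →* mulNorm Q T} (h : F.IsExtension Q φ φ') (e : R ≃* S)
    (he : ∀ x : R, (e x : Subgroup.normalizer (Q : Set P)) = φ x) :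
    image φ' = mulNorm Q S := by
  obtain ⟨-, h2, α, -, h4⟩ := h
  apply le_antisymm
  · have key : mulNorm Q R ≤
        ((mulNorm Q S).comap ((mulNorm Q T).subtype.comp φ')).map (mulNorm Q R).subtype := by
      refine sup_le ?_ ?_
      · rintro _ ⟨x, hx, rfl⟩
        refine ⟨⟨x, mulNorm_left ⟨x, hx⟩⟩, ?_, rfl⟩
        change (φ' ⟨x, mulNorm_left ⟨x, hx⟩⟩ : P) ∈ mulNorm Q S
        rw [h2 ⟨x, hx⟩, ← he]
        exact mulNorm_left _
      · intro x hx
        refine ⟨⟨x, mulNorm_right ⟨x, hx⟩⟩, ?_, rfl⟩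
        change (φ' ⟨x, mulNorm_right ⟨x, hx⟩⟩ : P) ∈ mulNorm Q S
        rw [h4 ⟨x, hx⟩]
        exact mulNorm_right _
    rintro _ ⟨_, ⟨x, rfl⟩, rfl⟩
    obtain ⟨y, hy, hxy⟩ := key x.2
    obtain rfl : y = x := Subtype.ext hxy
    exact hy
  · refine sup_le ?_ ?_
    · rintro _ ⟨y, hy, rfl⟩
      refine ⟨_, ⟨⟨_, mulNorm_left (e.symm ⟨y, hy⟩)⟩, rfl⟩, ?_⟩
      change (φ' _ : P) = _
      rw [h2, ← he]
      simp
    · intro y hy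
      refine ⟨_, ⟨⟨_, mulNorm_right (α.symm ⟨y, hy⟩)⟩, rfl⟩, ?_⟩
      change (φ' _ : P) = _
      rw [h4]
      simp

/-- The normaliser `N_F(Q)` of `Q` in `F`, a fusion system on `N_P(Q)`: its morphisms are the
`φ : R → T` which extend to a morphism `RQ → TQ` of `F` that restricts to an `F`-automorphism
of `Q`. -/
def normaliser (F : FusionSystem P) (Q : Subgroup P) :
    FusionSystem (Subgroup.normalizer (Q : Set P)) where
  Hom R T := {φ | ∃ φ', F.IsExtension Q φ φ'}
  injective := by
    rintro R T φ ⟨φ', h1, h2, -⟩ x y hxy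
    have h : φ' ⟨x, mulNorm_left x⟩ = φ' ⟨y, mulNorm_left y⟩ :=
      Subtype.ext (by rw [h2, h2, hxy])
    exact Subtype.ext (Subtype.ext (Subtype.mk.inj (F.injective h1 h)))
  id_mem R := ⟨MonoidHom.id _, F.id_mem _, fun x => rfl, MulEquiv.refl Q, F.id_mem Q, fun x => rfl⟩
  comp_mem := by
    rintro R T U φ ψ ⟨φ', h1, h2, α, h3, h4⟩ ⟨ψ', k1, k2, β, k3, k4⟩
    refine ⟨ψ'.comp φ', F.comp_mem h1 k1, fun x => ?_, α.trans β, F.comp_mem h3 k3, fun x => ?_⟩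
    · have : φ' ⟨x, mulNorm_left x⟩ = ⟨φ x, mulNorm_left (φ x)⟩ := Subtype.ext (h2 x)
      simp [this, k2]
    · have : φ' ⟨x, mulNorm_right x⟩ = ⟨α x, mulNorm_right (α x)⟩ := Subtype.ext (h4 x)
      simp [this, k4]
  conj_mem := by
    intro R T g φ h
    have hQ : ∀ x ∈ Q, (g : P)⁻¹ * x * g ∈ Q := fun x hx =>
      (Subgroup.mem_normalizer_iff''.1 g.2 x).1 hx
    have hQ' : ∀ x ∈ Q, (g : P) * x * (g : P)⁻¹ ∈ Q := fun x hx =>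
      (Subgroup.mem_normalizer_iff.1 g.2 x).1 hx
    have hle : mulNorm Q R ≤
        (mulNorm Q T).comap (MulAut.conj (g : P)⁻¹).toMonoidHom := by
      refine sup_le ?_ ?_
      · rintro _ ⟨x, hx, rfl⟩
        have := congrArg Subtype.val (h ⟨x, hx⟩)
        simp only [Subgroup.coe_mul, Subgroup.coe_inv] at this
        simpa [← this] using mulNorm_left (φ ⟨x, hx⟩)
      · intro x hx
        simpa using mulNorm_right (R := T) ⟨_, hQ x hx⟩
    refine ⟨((MulAut.conj (g : P)⁻¹).toMonoidHom.comp (mulNorm Q R).subtype).codRestrict _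
      (fun x => hle x.2), F.conj_mem (g : P) _ (fun x => by simp), fun x => by simp [h],
      ⟨⟨fun x => ⟨_, hQ x x.2⟩, fun x => ⟨_, hQ' x x.2⟩, fun x => ?_, fun x => ?_⟩, fun x y => ?_⟩,
      F.conj_mem (g : P) _ (fun x => rfl), fun x => by simp⟩
    · ext; simp [mul_assoc]
    · ext; simp [mul_assoc]
    · ext; simp [mul_assoc]
  iso_mem := by
    rintro R T S φ ⟨φ', h⟩ e he
    have he' : ∀ x : R, (e x : Subgroup.normalizer (Q : Set P)) = φ x := he
    have him := image_extension h e he'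
    obtain ⟨h1, h2, α, h3, h4⟩ := h
    have hinj : Function.Injective ((mulNorm Q T).subtype.comp φ') :=
      (Subgroup.subtype_injective _).comp (F.injective h1)
    have hrange : ((mulNorm Q T).subtype.comp φ').range = mulNorm Q S := by
      rw [← him, MonoidHom.range_comp]; rfl
    let E : mulNorm Q R ≃* mulNorm Q S :=
      (MonoidHom.ofInjective hinj).trans (MulEquiv.subgroupCongr hrange)
    have hE : ∀ x, (E x : P) = φ' x := fun x => rfl
    obtain ⟨m1, m2⟩ := F.iso_mem h1 E hE
    obtain ⟨a1, a2⟩ := F.iso_mem h3 α (fun x => rfl)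
    refine ⟨⟨E.toMonoidHom, m1, fun x => ?_, α, a1, fun x => ?_⟩,
      ⟨E.symm.toMonoidHom, m2, fun y => ?_, α.symm, a2, fun y => ?_⟩⟩
    · change (E _ : P) = _
      rw [hE, h2, ← he']; rfl
    · change (E _ : P) = _
      rw [hE, h4]
    · have : E ⟨_, mulNorm_left (e.symm y)⟩ = ⟨y, mulNorm_left y⟩ :=
        Subtype.ext (by rw [hE, h2, ← he']; simp)
      change (E.symm _ : P) = _
      rw [← this]; simp
    · have : E ⟨_, mulNorm_right (α.symm y)⟩ = ⟨y, mulNorm_right y⟩ :=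
        Subtype.ext (by rw [hE, h4]; simp)
      change (E.symm _ : P) = _
      rw [← this]; simp

/-- The finite group `L` is a model of the fusion system `F` on the `p`-group `P`: `L` is
`p`-constrained and `p'`-reduced, and `P` can be identified with a Sylow `p`-subgroup of `L` in
such a way that `F = F_P(L)`. -/
def IsModel (p : ℕ) (F : FusionSystem P) (L : Type*) [Group L] : Prop :=
  Subgroup.centralizer (pCore p L : Set L) ≤ pCore p L ∧
  pPrimeCore p L = ⊥ ∧
  ∃ (ι : P →* L) (hι : Function.Injective ι),
    (∃ S : Sylow p L, (S : Subgroup L) = ι.range) ∧ F = ofEmbedding ι hι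

/-- `F` is `Qd(p)`-free: `Qd(p)` is not involved in the models of the normalisers of the
`F`-centric fully `F`-normalised subgroups. -/
def IsQdFree (p : ℕ) (F : FusionSystem P) : Prop :=
  ∀ Q : Subgroup P, F.IsCentric Q → F.IsFullyNormalised Q →
    ∀ (L : Type u) [Group L] [Finite L], IsModel p (F.normaliser Q) L → ¬ Involves L (Qd p)

end FusionSystem

/-!
Let `V = 𝔽_p²`. If `G` has a section `V ⋊ SL₂(p)`, the Frattini argument provides a `p`-subgroup
`T` of `G` with a map onto `V` along which conjugations by elements of `G` induce all of `SL₂(p)`.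
Conversely, such a `T` yields a section `Qd(p)` again: as `p` is odd, `-1` fixes only `0` in `V`,
so in the group of pairs of an element of `G` and an element of `SL₂(p)` acting compatibly on `T`,
the normaliser `M` of a `2`-subgroup lying over `⟨-1⟩` still covers `SL₂(p)`. If `m ∈ M` and
`t ∈ T` have inverse components in `G`, then both are trivial in `Qd(p)`, hence `T ⋊ M → Qd(p)`
factors through a subgroup of `G`. This criterion concerns conjugation on a `p`-group. So if `Q`
is generated by `T` and a Sylow `p`-subgroup of `C_G(T)`, then `N_G(Q)` still involves `Qd(p)`, and
so does `N_G(Q) / O_{p'}(N_G(Q))`. After conjugating a Sylow `p`-subgroup of `N_G(Q)` into `P`, the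
latter is a model of `N_F(Q)`.

For the other implication let `L` be a model of `N_F(Q)` and `N = N_G(Q)`. The two groups have the
same fusion system, so `Q` is normal in both and every automorphism of `Q` induced by `L` is
induced by `N`. In the group of pairs `(n, l)` acting in the same way on `Q`, the kernel of the
projection to `N` is contained in `C_L(Q) ≤ Q`, hence an abelian normal `p`-subgroup, and it has a
complement in a Sylow `p`-subgroup, namely the diagonal copy of `N_P(Q)`. By Gaschütz's theorem it
has a complement in the whole group, which embeds into `N`; as it can be chosen to contain the
diagonal copy of `Q`, it maps onto `L`. So `L` is involved in `G`.
-/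

section Involves

variable {G L W X : Type*} [Group G] [Group L] [Group W] [Group X]

theorem involves_iff_exists_surjective :
    Involves G X ↔ ∃ (H : Subgroup G) (f : H →* X), Function.Surjective f := by
  constructor
  · rintro ⟨H, K, hK, ⟨e⟩⟩
    exact ⟨H, e.toMonoidHom.comp (QuotientGroup.mk' K),
      e.surjective.comp (QuotientGroup.mk'_surjective K)⟩
  · rintro ⟨H, f, hf⟩
    exact ⟨H, f.ker, inferInstance, ⟨QuotientGroup.quotientKerEquivOfSurjective f hf⟩⟩

theorem Involves.of_ker_le (a : W →* G) (b : W →* X) (hb : Function.Surjective b)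
    (h : a.ker ≤ b.ker) : Involves G X := by
  have ha : a.rangeRestrict.ker ≤ b.ker := a.ker_rangeRestrict.trans_le h
  refine involves_iff_exists_surjective.2
    ⟨a.range, a.rangeRestrict.liftOfSurjective a.rangeRestrict_surjective ⟨b, ha⟩, fun x => ?_⟩
  obtain ⟨w, rfl⟩ := hb x
  exact ⟨a.rangeRestrict w, a.rangeRestrict.liftOfRightInverse_comp_apply _ _ ⟨b, ha⟩ w⟩

theorem Involves.of_surjective {f : G →* X} (hf : Function.Surjective f) : Involves G X :=
  .of_ker_le (.id G) f hf (by simp)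

theorem Involves.trans (hGL : Involves G L) (hLX : Involves L X) : Involves G X := by
  obtain ⟨H, f, hf⟩ := involves_iff_exists_surjective.1 hGL
  obtain ⟨K, g, hg⟩ := involves_iff_exists_surjective.1 hLX
  have hinj : Function.Injective (H.subtype.comp (K.comap f).subtype) :=
    H.subtype_injective.comp (Subgroup.subtype_injective _)
  exact .of_ker_le (H.subtype.comp (K.comap f).subtype) (g.comp (f.subgroupComap K))
    (hg.comp (f.subgroupComap_surjective_of_surjective K hf))
    (((MonoidHom.ker_eq_bot_iff _).2 hinj).trans_le bot_le)

theorem Involves.of_subgroup {N : Subgroup G} (h : Involves N X) : Involves G X :=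
  (involves_iff_exists_surjective.2 ⟨N, .id N, Function.surjective_id⟩ : Involves G N).trans h

end Involves

section Gaschutz

open groupCohomology (IsMulCocycle₁)
open scoped IsMulCommutative

variable {U : Type*} [Group U]

/-- `D` is the corestriction `u ↦ ∏ t • α (t⁻¹ u t')` over coset representatives `t`, where `t'`
represents `u⁻¹ t H`. -/
theorem exists_isMulCocycle₁_corestrict {Z : Type*} [CommGroup Z] [MulDistribMulAction U Z]
    {H : Subgroup U} [H.FiniteIndex] {α : H → Z} (hα : IsMulCocycle₁ α) :
    ∃ D : U → Z, IsMulCocycle₁ D ∧ ∀ (u : U) (z : Z),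
      (∀ t : U, ∃ h : t⁻¹ * u * t ∈ H, t • α ⟨_, h⟩ = z) → D u = z ^ H.index := by
  let := H.fintypeQuotientOfFiniteIndex
  have hmem (g : U) (q : U ⧸ H) : q.out⁻¹ * g * (g⁻¹ • q).out ∈ H := by
    rw [mul_assoc, ← QuotientGroup.eq, QuotientGroup.out_eq', ← smul_eq_mul (a := g),
      ← MulAction.Quotient.smul_coe, QuotientGroup.out_eq', smul_inv_smul]
  refine ⟨fun g => ∏ q : U ⧸ H, q.out • α ⟨_, hmem g q⟩, fun g h => ?_, fun u z hz => ?_⟩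
  · rw [Finset.smul_prod', ← Equiv.prod_comp (MulAction.toPerm g⁻¹)
      (fun q : U ⧸ H => g • q.out • α ⟨_, hmem h q⟩), ← Finset.prod_mul_distrib]
    refine Finset.prod_congr rfl fun q _ => ?_
    have hmul : (⟨_, hmem (g * h) q⟩ : H) = ⟨_, hmem g q⟩ * ⟨_, hmem h (g⁻¹ • q)⟩ := by
      ext
      simp [mul_assoc, mul_smul]
    rw [hmul, hα, smul_mul', Subgroup.smul_def, ← mul_smul q.out, ← mul_smul g]
    simp [mul_assoc]
  · have hfix (q : U ⧸ H) : u⁻¹ • q = q := by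
      obtain ⟨h, -⟩ := hz q.out
      rw [inv_smul_eq_iff, ← QuotientGroup.out_eq' q, MulAction.Quotient.smul_coe,
        QuotientGroup.eq, smul_eq_mul, ← mul_assoc]
      exact h
    have hterm (q : U ⧸ H) : q.out • α ⟨_, hmem u q⟩ = z := by
      obtain ⟨h, hq⟩ := hz q.out
      rw [← hq]
      congr 3
      rw [hfix q]
    simp only [hterm, Finset.prod_const, Finset.card_univ, Subgroup.index_eq_card,
      Nat.card_eq_fintype_card]

theorem exists_isMulCocycle₁_of_disjoint (A K : Subgroup U) [A.Normal] [IsMulCommutative A]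
    [MulDistribMulAction U A]
    (hsmul : ∀ (u : U) (a : A), ((u • a : A) : U) = u * a * u⁻¹) (hAK : Disjoint A K) :
    ∃ α : (A ⊔ K : Subgroup U) → A, IsMulCocycle₁ α ∧
      ∀ (a : A) (h : (A ⊔ K : Subgroup U)), (a : U)⁻¹ * h ∈ K → α h = a := by
  have hex (h : (A ⊔ K : Subgroup U)) : ∃ a : A, (a : U)⁻¹ * h ∈ K := by
    obtain ⟨a, ha, k, hk, hak⟩ := Subgroup.mem_sup_of_normal_left.1 h.2
    exact ⟨⟨a, ha⟩, by simpa [← hak] using hk⟩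
  choose α hα using hex
  have hunique (a : A) (h : (A ⊔ K : Subgroup U)) (ha : (a : U)⁻¹ * h ∈ K) : α h = a := by
    have hK : (a : U)⁻¹ * α h ∈ K := by
      simpa [mul_assoc] using mul_mem ha (inv_mem (hα h))
    have hA : (a : U)⁻¹ * α h ∈ A := mul_mem (inv_mem a.2) (α h).2
    exact Subtype.ext (inv_mul_eq_one.1 (Subgroup.disjoint_def.1 hAK hA hK)).symm
  refine ⟨α, fun g h => hunique _ _ ?_, hunique⟩
  simpa [Subgroup.smul_def, hsmul, mul_assoc] using mul_mem (hα g) (hα h)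

/-- The kernel of a crossed homomorphism: a subgroup, in general not normal. -/
def cocycleKer {Z : Type*} [CommGroup Z] [MulDistribMulAction U Z] {D : U → Z}
    (hD : IsMulCocycle₁ D) : Subgroup U where
  carrier := {u | D u = 1}
  one_mem' := groupCohomology.map_one_of_isMulCocycle₁ hD
  mul_mem' := fun {u v} (hu : D u = 1) (hv : D v = 1) => by simp [hD u v, hu, hv]
  inv_mem' := fun {u} (hu : D u = 1) => by
    have := groupCohomology.map_inv_of_isMulCocycle₁ hD u
    rw [hu, inv_one, smul_eq_iff_eq_inv_smul, smul_one] at this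
    exact this

theorem isComplement'_cocycleKer {A : Subgroup U} [IsMulCommutative A] [MulDistribMulAction U A]
    {D : U → A} (hD : IsMulCocycle₁ D) (hbij : Function.Bijective fun a : A => D a) :
    A.IsComplement' (cocycleKer hD) := by
  refine Subgroup.isComplement'_of_disjoint_and_mul_eq_univ ?_ (Set.eq_univ_of_forall fun u => ?_)
  · refine Subgroup.disjoint_def.2 fun {a} ha (haD : D a = 1) => ?_
    have hD1 : D (1 : A) = 1 := groupCohomology.map_one_of_isMulCocycle₁ hD
    exact congrArg Subtype.val (hbij.1 (a₁ := ⟨a, ha⟩) (haD.trans hD1.symm))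
  · obtain ⟨a, ha⟩ := hbij.2 (D u)
    refine ⟨a, a.2, (a : U)⁻¹ * u, ?_, by simp⟩
    have hmul := hD a ((a : U)⁻¹ * u)
    rw [mul_inv_cancel_left, show D a = D u from ha, right_eq_mul, smul_eq_iff_eq_inv_smul,
      smul_one] at hmul
    exact hmul

/-- **Gaschütz**: the obvious projection `A ⊔ K → A` is a cocycle, and its corestriction `D` to
`U` is on `A` the bijection `a ↦ a ^ index`; the complement is the kernel of `D`. -/
theorem exists_isComplement'_of_disjoint_of_coprime_index (A K : Subgroup U) [A.Normal]
    [IsMulCommutative A] [(A ⊔ K).FiniteIndex] (hAK : Disjoint A K)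
    (hcop : (Nat.card A).Coprime (A ⊔ K).index) :
    ∃ W : Subgroup U, A.IsComplement' W ∧ K.normalCore ≤ W := by
  let : MulDistribMulAction U A := .compHom A (MulAut.conjNormal (H := A))
  have hsmul (u : U) (a : A) : ((u • a : A) : U) = u * a * u⁻¹ := MulAut.conjNormal_apply u a
  obtain ⟨α, hα, hαeq⟩ := exists_isMulCocycle₁_of_disjoint A K hsmul hAK
  obtain ⟨D, hD, hDeq⟩ := exists_isMulCocycle₁_corestrict hα
  have hDA (a : A) : D a = a ^ (A ⊔ K).index := by
    refine hDeq a a fun t => ?_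
    have ht : t⁻¹ * a * t ∈ A := by simpa using (inferInstance : A.Normal).conj_mem a a.2 t⁻¹
    refine ⟨Subgroup.mem_sup_left ht, ?_⟩
    rw [hαeq ⟨_, ht⟩ _ (by simp [mul_assoc])]
    ext
    simp [hsmul, mul_assoc]
  have hDK (k : U) (hk : k ∈ K.normalCore) : D k = 1 := by
    rw [hDeq k 1 fun t => ?_, one_pow]
    have ht : t⁻¹ * k * t ∈ K := by simpa using hk t⁻¹
    exact ⟨Subgroup.mem_sup_right ht, by rw [hαeq 1 _ (by simpa using ht), smul_one]⟩
  refine ⟨cocycleKer hD, isComplement'_cocycleKer hD ?_, hDK⟩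
  simpa only [hDA, ← powCoprime_apply hcop] using (powCoprime hcop).bijective

end Gaschutz

section Frattini

variable {M X : Type*} [Group M] [Finite M] [Group X] {q : ℕ} [Fact q.Prime] {θ : M →* X}
  (hθ : Function.Surjective θ) {D : Subgroup X} (hD : IsPGroup q D) (Z : Sylow q (D.comap θ))

include hθ hD

theorem map_sylow_comap : ((Z : Subgroup (D.comap θ)).map (D.comap θ).subtype).map θ = D := by
  have hsurj := θ.subgroupComap_surjective_of_surjective D hθ
  have htop : (Z : Subgroup (D.comap θ)).map (θ.subgroupComap D) = ⊤ := by
    rw [← Sylow.coe_mapSurjective hsurj, ← top_le_iff]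
    exact (hD.to_subgroup ⊤).le_sylow_of_normal _
  have hcomp : θ.comp (D.comap θ).subtype = D.subtype.comp (θ.subgroupComap D) := rfl
  rw [Subgroup.map_map, hcomp, ← Subgroup.map_map, htop, ← MonoidHom.range_eq_map,
    Subgroup.range_subtype]

theorem map_normalizer_sylow_comap [D.Normal] :
    (Subgroup.normalizer ((Z : Subgroup (D.comap θ)).map (D.comap θ).subtype : Set M)).map θ =
      ⊤ := by
  have hle : D ≤ (Subgroup.normalizer
      ((Z : Subgroup (D.comap θ)).map (D.comap θ).subtype : Set M)).map θ :=
    (map_sylow_comap hθ hD Z).symm.trans_le (Subgroup.map_mono Subgroup.le_normalizer)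
  have hFrattini := congrArg (Subgroup.map θ) Z.normalizer_sup_eq_top
  rwa [Subgroup.map_sup, Subgroup.map_comap_eq_self_of_surjective hθ, sup_of_le_left hle,
    Subgroup.map_top_of_surjective θ hθ] at hFrattini

end Frattini

section InducesAction

variable {T Γ V X : Type*} [Group T] [Group Γ] [Group V] [Group X]

/-- The triples `(α, g, x)` for which `α : MulAut T` is compatible, along `j : T →* Γ`, with
conjugation by `g` and, along `f : T →* V`, with the action of `x` on `V`. -/
def compatible (φ : X →* MulAut V) (j : T →* Γ) (f : T →* V) : Subgroup (MulAut T × Γ × X) where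
  carrier := {m | ∀ t, j (m.1 t) = m.2.1 * j t * m.2.1⁻¹ ∧ f (m.1 t) = φ m.2.2 (f t)}
  one_mem' := by simp
  mul_mem' hm hn t := by simp [hm _, hn _, mul_assoc]
  inv_mem' {m} hm t := by
    have ht := hm (m.1⁻¹ t)
    simp only [MulAut.apply_inv_self] at ht
    simp [ht, mul_assoc]

namespace compatible

variable (φ : X →* MulAut V) (j : T →* Γ) (f : T →* V)

/-- The automorphism of `T` in a compatible triple. -/
def aut : compatible φ j f →* MulAut T := (MonoidHom.fst _ _).comp (compatible φ j f).subtype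

/-- The element of `Γ` in a compatible triple. -/
def elt : compatible φ j f →* Γ :=
  (MonoidHom.fst _ _).comp ((MonoidHom.snd _ _).comp (compatible φ j f).subtype)

/-- The element of `X` in a compatible triple. -/
def act : compatible φ j f →* X :=
  (MonoidHom.snd _ _).comp ((MonoidHom.snd _ _).comp (compatible φ j f).subtype)

variable {φ j f} (m : compatible φ j f) (t : T)

theorem map_aut_left : j (aut φ j f m t) = elt φ j f m * j t * (elt φ j f m)⁻¹ := (m.2 t).1

theorem map_aut_right : f (aut φ j f m t) = φ (act φ j f m) (f t) := (m.2 t).2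

theorem aut_apply_of_elt_eq (hj : Function.Injective j) {m : compatible φ j f} {t : T}
    (h : elt φ j f m = j t⁻¹) (s : T) : aut φ j f m s = t⁻¹ * s * t :=
  hj (by simp [map_aut_left, h])

end compatible

/-- Along `j : T →* Γ` and `f : T →* V`, conjugations in `Γ` induce all of the action of `X`
on `V`. -/
def InducesAction (φ : X →* MulAut V) (j : T →* Γ) (f : T →* V) : Prop :=
  ∀ x : X, ∃ α g, (α, g, x) ∈ compatible φ j f

variable {φ : X →* MulAut V} {j : T →* Γ} {f : T →* V}

theorem InducesAction.comp {Δ : Type*} [Group Δ] (h : InducesAction φ j f) (ψ : Γ →* Δ) :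
    InducesAction φ (ψ.comp j) f := fun x => by
  obtain ⟨α, g, hg⟩ := h x
  exact ⟨α, ψ g, fun t => ⟨by simp [(hg t).1], (hg t).2⟩⟩

theorem eq_one_of_pow_pow_eq_one {q : ℕ} (hV : ∀ v : V, v ^ q = 1 → v = 1) (k : ℕ) :
    ∀ v : V, v ^ q ^ k = 1 → v = 1 := by
  induction k with
  | zero => simp
  | succ k ih => exact fun v hv => ih v (hV _ (by rwa [← pow_mul, ← pow_succ]))

theorem compatible.act_eq_one_of_elt_eq {V : Type*} [CommGroup V] {φ : X →* MulAut V} {f : T →* V}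
    (hj : Function.Injective j) (hf : Function.Surjective f) (hφ : Function.Injective φ)
    {m : compatible φ j f} {t : T} (hmt : elt φ j f m = j t⁻¹) : act φ j f m = 1 := by
  refine hφ (MulEquiv.ext fun v => ?_)
  obtain ⟨s, rfl⟩ := hf v
  rw [← map_aut_right, aut_apply_of_elt_eq hj hmt]
  simp [mul_comm]

/-- For `z ∈ Z` the commutator `m * z * m⁻¹ * z⁻¹` lies in the `q`-group `Z`, and its component
in `Γ` is `j (t⁻¹ * aut z t)`. -/
theorem compatible.map_eq_one_of_elt_eq {V : Type*} [CommGroup V] {φ : X →* MulAut V} {f : T →* V}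
    (hj : Function.Injective j) {q : ℕ} (hV : ∀ v : V, v ^ q = 1 → v = 1)
    {Z : Subgroup (compatible φ j f)} (hZ : IsPGroup q Z)
    (hfix : ∀ v : V, (∀ z ∈ Z, φ (act φ j f z) v = v) → v = 1)
    {m : compatible φ j f} (hm : m ∈ Subgroup.normalizer (Z : Set (compatible φ j f)))
    {t : T} (hmt : elt φ j f m = j t⁻¹) : f t = 1 := by
  refine hfix _ fun z hz => ?_
  have hcomm : m * z * m⁻¹ * z⁻¹ ∈ Z :=
    mul_mem ((Subgroup.mem_normalizer_iff.1 hm z).1 hz) (inv_mem hz)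
  have helt : elt φ j f (m * z * m⁻¹ * z⁻¹) = j (t⁻¹ * aut φ j f z t) := by
    simp [hmt, map_aut_left, mul_assoc]
  obtain ⟨k, hk⟩ := hZ ⟨_, hcomm⟩
  have hpow : j ((t⁻¹ * aut φ j f z t) ^ q ^ k) = 1 := by
    have hk' : (m * z * m⁻¹ * z⁻¹) ^ q ^ k = 1 := congrArg Subtype.val hk
    rw [map_pow, ← helt, ← map_pow, hk', map_one]
  have hone : f (t⁻¹ * aut φ j f z t) = 1 := by
    refine eq_one_of_pow_pow_eq_one hV k _ ?_
    rw [← map_pow, (map_eq_one_iff j hj).1 hpow, map_one]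
  rwa [map_mul, map_inv, map_aut_right, inv_mul_eq_one, eq_comm] at hone

theorem compatible.involves_semidirectProduct {N : Subgroup (compatible φ j f)}
    (hN : N.map (act φ j f) = ⊤) (hf : Function.Surjective f)
    (hker : ∀ m ∈ N, ∀ t, elt φ j f m = j t⁻¹ → act φ j f m = 1 ∧ f t = 1) :
    Involves Γ (V ⋊[φ] X) := by
  let ρ : N →* MulAut T := (aut φ j f).comp N.subtype
  let a : T ⋊[ρ] N →* Γ := SemidirectProduct.lift j ((elt φ j f).comp N.subtype) fun m => by
    ext t
    exact map_aut_left m.1 t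
  let b : T ⋊[ρ] N →* V ⋊[φ] X := SemidirectProduct.map f ((act φ j f).comp N.subtype) fun m => by
    ext t
    exact map_aut_right m.1 t
  refine .of_ker_le a b (fun y => ?_) fun w hw => ?_
  · obtain ⟨t, ht⟩ := hf y.left
    obtain ⟨m, hm, hmy⟩ := hN.ge (Subgroup.mem_top y.right)
    exact ⟨⟨t, m, hm⟩, SemidirectProduct.ext ht hmy⟩
  · have hw' : j w.left * elt φ j f w.right = 1 := hw
    obtain ⟨hact, hleft⟩ := hker w.right w.right.2 w.left
      (by rw [map_inv, eq_inv_of_mul_eq_one_right hw'])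
    exact SemidirectProduct.ext hleft hact

theorem InducesAction.act_surjective (h : InducesAction φ j f) :
    Function.Surjective (compatible.act φ j f) := fun x => by
  obtain ⟨α, g, hg⟩ := h x
  exact ⟨⟨_, hg⟩, rfl⟩

open compatible in
/-- If the `q`-subgroup `Z` of `compatible φ j f` lies over `D` and its normaliser `N` covers `X`,
then the section of `Γ` is the image of `T ⋊ N`, which maps onto `V ⋊ X`. -/
theorem InducesAction.involves_semidirectProduct {V : Type*} [CommGroup V] {φ : X →* MulAut V}
    {f : T →* V} [Finite Γ] [Finite X] (h : InducesAction φ j f) (hj : Function.Injective j)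
    (hf : Function.Surjective f) (hφ : Function.Injective φ) {q : ℕ} [Fact q.Prime]
    (hV : ∀ v : V, v ^ q = 1 → v = 1) {D : Subgroup X} [D.Normal] (hD : IsPGroup q D)
    (hfix : ∀ v : V, (∀ d ∈ D, φ d v = v) → v = 1) : Involves Γ (V ⋊[φ] X) := by
  have := Finite.of_injective j hj
  let S : Sylow q (D.comap (act φ j f)) := default
  refine compatible.involves_semidirectProduct (map_normalizer_sylow_comap h.act_surjective hD S) hf
    fun m hm t hmt => ⟨act_eq_one_of_elt_eq hj hf hφ hmt, ?_⟩
  refine map_eq_one_of_elt_eq hj hV (S.2.map _) (fun v hv => hfix v fun d hd => ?_) hm hmt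
  obtain ⟨z, hz, rfl⟩ := (map_sylow_comap h.act_surjective hD S).ge hd
  exact hv z hz

theorem exists_inducesAction_of_surjective [Finite Γ] {p : ℕ} [Fact p.Prime] (hV : IsPGroup p V)
    (g : Γ →* V ⋊[φ] X) (hg : Function.Surjective g) :
    ∃ (T : Subgroup Γ) (f : T →* V), IsPGroup p T ∧ Function.Surjective f ∧
      InducesAction φ T.subtype f := by
  let D : Subgroup (V ⋊[φ] X) := SemidirectProduct.inl.range
  have hDker : D = SemidirectProduct.rightHom.ker := SemidirectProduct.range_inl_eq_ker_rightHom
  have : D.Normal := hDker ▸ inferInstance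
  have hD : IsPGroup p D := hV.of_surjective _ SemidirectProduct.inl.rangeRestrict_surjective
  let S : Sylow p (D.comap g) := default
  let T := (S : Subgroup (D.comap g)).map (D.comap g).subtype
  have hTD : T.map g = D := map_sylow_comap hg hD S
  have hN : (Subgroup.normalizer (T : Set Γ)).map g = ⊤ := map_normalizer_sylow_comap hg hD S
  let e := (MonoidHom.ofInjective (SemidirectProduct.inl_injective (φ := φ))).symm
  let f : T →* V := e.toMonoidHom.comp
    ((g.comp T.subtype).codRestrict D fun t => hTD.le (Subgroup.mem_map_of_mem g t.2))
  have hf (t : T) : SemidirectProduct.inl (f t) = g t :=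
    MonoidHom.apply_ofInjective_symm SemidirectProduct.inl_injective _
  refine ⟨T, f, S.2.map _, fun v => ?_, fun x => ?_⟩
  · obtain ⟨t, ht, htv⟩ := hTD.ge ⟨v, rfl⟩
    exact ⟨⟨t, ht⟩, SemidirectProduct.inl_injective ((hf _).trans htv)⟩
  · obtain ⟨n, hn, hnx⟩ := hN.ge (Subgroup.mem_top (SemidirectProduct.inr x))
    refine ⟨T.normalizerMonoidHom ⟨n, hn⟩, n, fun t => ⟨rfl, ?_⟩⟩
    have hconj : ((T.normalizerMonoidHom ⟨n, hn⟩ t : T) : Γ) = n * t * n⁻¹ := rfl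
    refine SemidirectProduct.inl_injective (φ := φ) ?_
    rw [SemidirectProduct.inl_aut, hf, hf, hconj, map_inv, ← hnx, map_mul, map_mul, map_inv]

theorem Involves.exists_inducesAction {Γ : Type u} [Group Γ] [Finite Γ] {p : ℕ} [Fact p.Prime]
    (hV : IsPGroup p V) (h : Involves Γ (V ⋊[φ] X)) :
    ∃ (T : Type u) (_ : Group T) (j : T →* Γ) (f : T →* V), IsPGroup p T ∧
      Function.Injective j ∧ Function.Surjective f ∧ InducesAction φ j f := by
  obtain ⟨H, g, hg⟩ := involves_iff_exists_surjective.1 h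
  obtain ⟨T, f, hT, hf, hind⟩ := exists_inducesAction_of_surjective hV g hg
  exact ⟨T, inferInstance, H.subtype.comp T.subtype, f, hT,
    H.subtype_injective.comp T.subtype_injective, hf, hind.comp H.subtype⟩

end InducesAction

section PCentric

variable {G : Type*} [Group G] {p : ℕ}

/-- For a `p`-subgroup `Q` of a finite group this is the usual notion: `Z(Q)` is a Sylow
`p`-subgroup of `C_G(Q)`. -/
def IsPCentric (p : ℕ) (Q : Subgroup G) : Prop :=
  ∀ R ≤ Subgroup.centralizer (Q : Set G), IsPGroup p R → R ≤ Q

/-- `Q` is generated by `A` and a Sylow `p`-subgroup of `C_G(A)`. -/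
theorem exists_isPCentric_ge [Finite G] [Fact p.Prime] {A : Subgroup G} (hA : IsPGroup p A) :
    ∃ Q, A ≤ Q ∧ IsPGroup p Q ∧ IsPCentric p Q ∧
      ∀ g ∈ Subgroup.normalizer (A : Set G), ∃ c ∈ Subgroup.centralizer (A : Set G),
        g * c ∈ Subgroup.normalizer (Q : Set G) := by
  let N := Subgroup.normalizer (A : Set G)
  let C := (Subgroup.centralizer (A : Set G)).subgroupOf N
  have hCker : C = A.normalizerMonoidHom.ker := A.normalizerMonoidHom_ker.symm
  have : C.Normal := hCker ▸ inferInstance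
  let S : Sylow p C := default
  let SN := (S : Subgroup C).map C.subtype
  have hSC : SN.map N.subtype ≤ Subgroup.centralizer (A : Set G) := by
    rintro _ ⟨_, ⟨c, -, rfl⟩, rfl⟩
    exact c.2
  have hAN : A ≤ Subgroup.normalizer (SN.map N.subtype : Set G) :=
    (Subgroup.le_centralizer_iff.1 hSC).trans (Subgroup.centralizer_le_normalizer _)
  refine ⟨A ⊔ SN.map N.subtype, le_sup_left,
    hA.to_sup_of_normal_right' ((S.2.map _).map _) hAN, fun R hRC hR r hr => ?_, fun g hg => ?_⟩
  · have hRA : R ≤ Subgroup.centralizer (A : Set G) :=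
      hRC.trans (Subgroup.centralizer_le (SetLike.coe_subset_coe.2 le_sup_left))
    have hRN : R ≤ N := hRA.trans (Subgroup.centralizer_le_normalizer _)
    let R' := (R.subgroupOf N).subgroupOf C
    have hR' : IsPGroup p R' := hR.comap_subtype.comap_subtype
    have hR'S : R' ≤ Subgroup.centralizer (S : Set C) := fun x hx s hs =>
      Subtype.ext (Subtype.ext (hRC hx s (Subgroup.mem_sup_right ⟨s, ⟨s, hs, rfl⟩, rfl⟩)))
    let c : C := ⟨⟨r, hRN hr⟩, hRA hr⟩
    have hc : c ∈ R' := hr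
    have hcS : c ∈ R' ⊓ S := (hR'.inf_normalizer_sylow S).le
      ⟨hc, Subgroup.centralizer_le_normalizer _ (hR'S hc)⟩
    exact Subgroup.mem_sup_right ⟨_, ⟨_, hcS.2, rfl⟩, rfl⟩
  · obtain ⟨n, hn, c, hc, hnc⟩ := Subgroup.mem_sup_of_normal_right.1
      (S.normalizer_sup_eq_top.ge (Subgroup.mem_top (⟨g, hg⟩ : N)))
    refine ⟨(c : G)⁻¹, inv_mem hc, ?_⟩
    have hgn : g * (c : G)⁻¹ = n := by
      rw [mul_inv_eq_iff_eq_mul]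
      exact congrArg Subtype.val hnc.symm
    rw [hgn]
    exact Subgroup.normalizer_inf_normalizer_le_normalizer_sup _ _
      ⟨n.2, Subgroup.le_normalizer_map _ (Subgroup.mem_map_of_mem N.subtype hn)⟩

theorem InducesAction.exists_isPCentric [Finite G] [Fact p.Prime] {T V X : Type*} [Group T]
    [Group V] [Group X] {φ : X →* MulAut V} {j : T →* G} {f : T →* V} (h : InducesAction φ j f)
    (hT : IsPGroup p T) :
    ∃ (Q : Subgroup G) (hQ : j.range ≤ Subgroup.normalizer (Q : Set G)), IsPGroup p Q ∧
      IsPCentric p Q ∧ InducesAction φ (j.codRestrict _ fun t => hQ ⟨t, rfl⟩) f := by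
  obtain ⟨Q, hjQ, hQ, hcent, hfrattini⟩ :=
    exists_isPCentric_ge (hT.of_surjective _ j.rangeRestrict_surjective)
  refine ⟨Q, hjQ.trans Subgroup.le_normalizer, hQ, hcent, fun x => ?_⟩
  obtain ⟨α, g, hg⟩ := h x
  have hgN : g ∈ Subgroup.normalizer (j.range : Set G) := by
    refine Subgroup.mem_normalizer_fintype ?_
    rintro _ ⟨t, rfl⟩
    exact ⟨α t, (hg t).1⟩
  obtain ⟨c, hc, hgc⟩ := hfrattini g hgN
  refine ⟨α, ⟨g * c, hgc⟩, fun t => ⟨Subtype.ext ?_, (hg t).2⟩⟩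
  have hct : c * j t * c⁻¹ = j t := by rw [← hc _ ⟨t, rfl⟩, mul_inv_cancel_right]
  calc j (α t) = g * (c * j t * c⁻¹) * g⁻¹ := by rw [hct, (hg t).1]
    _ = g * c * j t * (g * c)⁻¹ := by group

end PCentric

section Qd

namespace Qd

variable {p : ℕ}

theorem action_injective : Function.Injective (action p) := fun _ _ h =>
  Matrix.SpecialLinearGroup.toLin'_injective <| LinearEquiv.ext fun v =>
    congrArg Multiplicative.toAdd (DFunLike.congr_fun h (Multiplicative.ofAdd v))

theorem action_neg_one (v : Multiplicative (Fin 2 → ZMod p)) : action p (-1) v = v⁻¹ := by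
  change Multiplicative.ofAdd ((-1 : Matrix (Fin 2) (Fin 2) (ZMod p)).mulVec v.toAdd) = v⁻¹
  rw [Matrix.neg_mulVec, Matrix.one_mulVec]
  rfl

theorem isPGroup_vector : IsPGroup p (Multiplicative (Fin 2 → ZMod p)) := fun v =>
  ⟨1, Multiplicative.toAdd.injective (by ext i; simp)⟩

theorem eq_one_of_sq_eq_one [Fact p.Prime] (hp : p ≠ 2) {v : Multiplicative (Fin 2 → ZMod p)}
    (h : v ^ 2 = 1) : v = 1 := by
  have hcop : (orderOf v).Coprime 2 :=
    isPGroup_vector.orderOf_coprime ((Nat.coprime_primes Fact.out Nat.prime_two).2 hp) v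
  exact orderOf_eq_one_iff.1 (hcop.eq_one_of_dvd (orderOf_dvd_of_pow_eq_one h))

instance normal_zpowers_neg_one :
    (Subgroup.zpowers (-1 : Matrix.SpecialLinearGroup (Fin 2) (ZMod p))).Normal := by
  refine ⟨?_⟩
  rintro _ ⟨k, rfl⟩ A
  have hcomm : Commute A (-1) := Subtype.ext (by simp)
  exact ⟨k, by simp [(hcomm.zpow_right k).eq]⟩

theorem isPGroup_zpowers_neg_one :
    IsPGroup 2 (Subgroup.zpowers (-1 : Matrix.SpecialLinearGroup (Fin 2) (ZMod p))) := by
  refine .of_card_dvd_pow (n := 1) ?_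
  rw [Nat.card_zpowers]
  exact orderOf_dvd_of_pow_eq_one (by simp)

theorem involves_of_inducesAction [Fact p.Prime] (hp : p ≠ 2) {T Γ : Type*} [Group T] [Group Γ]
    [Finite Γ] {j : T →* Γ} {f : T →* Multiplicative (Fin 2 → ZMod p)}
    (h : InducesAction (action p) j f) (hj : Function.Injective j)
    (hf : Function.Surjective f) : Involves Γ (Qd p) := by
  refine h.involves_semidirectProduct hj hf action_injective (q := 2)
    (fun v => eq_one_of_sq_eq_one hp) isPGroup_zpowers_neg_one fun v hv => ?_
  have hv' : v⁻¹ = v := action_neg_one v ▸ hv _ (Subgroup.mem_zpowers _)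
  exact eq_one_of_sq_eq_one hp (by rw [sq, mul_eq_one_iff_eq_inv, hv'])

end Qd

theorem Involves.exists_isPCentric {p : ℕ} [Fact p.Prime] (hp : p ≠ 2) {G : Type u} [Group G]
    [Finite G] (h : Involves G (Qd p)) :
    ∃ Q : Subgroup G, IsPGroup p Q ∧ IsPCentric p Q ∧
      Involves (Subgroup.normalizer (Q : Set G)) (Qd p) := by
  obtain ⟨T, _, j, f, hT, hj, hf, hind⟩ := h.exists_inducesAction Qd.isPGroup_vector
  obtain ⟨Q, hQN, hQ, hcent, hindN⟩ := hind.exists_isPCentric hT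
  exact ⟨Q, hQ, hcent,
    Qd.involves_of_inducesAction hp hindN ((MonoidHom.injective_codRestrict _ _ _).2 hj) hf⟩

theorem Involves.quotient_of_coprime {p : ℕ} [Fact p.Prime] (hp : p ≠ 2) {G : Type u} [Group G]
    [Finite G] (h : Involves G (Qd p)) {K : Subgroup G} [K.Normal] (hK : p.Coprime (Nat.card K)) :
    Involves (G ⧸ K) (Qd p) := by
  obtain ⟨T, _, j, f, hT, hj, hf, hind⟩ := h.exists_inducesAction Qd.isPGroup_vector
  refine Qd.involves_of_inducesAction hp (hind.comp (QuotientGroup.mk' K)) ?_ hf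
  refine (injective_iff_map_eq_one _).2 fun t ht => ?_
  have htK : j t ∈ K := (QuotientGroup.eq_one_iff _).1 ht
  have hdisj : Disjoint j.range K :=
    (hT.of_surjective _ j.rangeRestrict_surjective).disjoint_of_coprime .card hK
  exact (map_eq_one_iff j hj).1 (Subgroup.disjoint_def.1 hdisj ⟨t, rfl⟩ htK)

end Qd

section Cores

variable {p : ℕ} {L : Type*} [Group L]

instance normal_pCore : (pCore p L).Normal := Subgroup.sSup_normal _ fun _ h => h.1

instance normal_pPrimeCore : (pPrimeCore p L).Normal := Subgroup.sSup_normal _ fun _ h => h.1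

theorem pCore_le_sylow (S : Sylow p L) : pCore p L ≤ S :=
  sSup_le fun _ hN => have := hN.1; hN.2.le_sylow_of_normal S

theorem le_pCore {N : Subgroup L} [hN : N.Normal] (h : IsPGroup p N) : N ≤ pCore p L :=
  le_sSup ⟨hN, h⟩

theorem le_pPrimeCore {N : Subgroup L} [hN : N.Normal] (h : (Nat.card N).Coprime p) :
    N ≤ pPrimeCore p L :=
  le_sSup ⟨hN, h⟩

theorem coprime_card_pPrimeCore [Fact p.Prime] [Finite L] :
    p.Coprime (Nat.card (pPrimeCore p L)) := by
  have hcop : (ordCompl[p] (Nat.card L)).Coprime p :=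
    (Nat.coprime_ordCompl Fact.out Nat.card_pos.ne').symm
  have hcore : IsPGroup (ordCompl[p] (Nat.card L)) (pPrimeCore p L) := by
    refine Sylow.sSup_of_normal _ (fun N hN => .of_card_dvd_pow (n := 1) ?_) fun N hN => hN.1
    rw [pow_one]
    refine (hN.2.pow_right ((Nat.card L).factorization p)).dvd_of_dvd_mul_left ?_
    rw [Nat.ordProj_mul_ordCompl_eq_self]
    exact N.card_subgroup_dvd_card
  refine (Nat.Prime.coprime_iff_not_dvd Fact.out).2 fun hdvd => ?_
  obtain ⟨x, hx⟩ := exists_prime_orderOf_dvd_card' p hdvd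
  exact hcore.orderOf_coprime hcop x |>.symm.eq_one_of_dvd hx.symm.dvd |> Nat.Prime.ne_one Fact.out

instance characteristic_pPrimeCore [Fact p.Prime] [Finite L] : (pPrimeCore p L).Characteristic :=
  Subgroup.characteristic_iff_map_le.2 fun e =>
    have := (normal_pPrimeCore (p := p)).map e.toMonoidHom e.surjective
    le_pPrimeCore (by
      rw [Subgroup.card_map_of_injective e.injective]
      exact coprime_card_pPrimeCore.symm)

theorem map_subtype_pPrimeCore_le [Fact p.Prime] [Finite L] (N : Subgroup L) [N.Normal] :
    (pPrimeCore p N).map N.subtype ≤ pPrimeCore p L :=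
  have := ConjAct.normal_of_characteristic_of_normal (H := N) (K := pPrimeCore p N)
  le_pPrimeCore (by
    rw [Subgroup.card_map_of_injective N.subtype_injective]
    exact coprime_card_pPrimeCore.symm)

theorem sup_pPrimeCore_eq_top_of_normalizer_le_centralizer [Fact p.Prime] [Finite L]
    (S : Sylow p L) (hS : Subgroup.normalizer (S : Set L) ≤ Subgroup.centralizer (S : Set L)) :
    (S : Subgroup L) ⊔ pPrimeCore p L = ⊤ := by
  have hcore : (MonoidHom.transferSylow S hS).ker ≤ pPrimeCore p L :=
    le_pPrimeCore ((Nat.Prime.coprime_iff_not_dvd Fact.out).2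
      (MonoidHom.not_dvd_card_ker_transferSylow S hS)).symm
  rw [← top_le_iff, ← (MonoidHom.ker_transferSylow_isComplement' S hS).sup_eq_top, sup_comm]
  exact sup_le_sup_left hcore _

theorem IsPCentric.centralizer_le_sup_pPrimeCore [Fact p.Prime] [Finite L] {Q : Subgroup L}
    [Q.Normal] (hQ : IsPCentric p Q) :
    Subgroup.centralizer (Q : Set L) ≤ Q ⊔ pPrimeCore p L := by
  let C := Subgroup.centralizer (Q : Set L)
  have : C.Normal := Subgroup.normal_centralizer
  let S : Sylow p C := default
  have hSQ : (S : Subgroup C).map C.subtype ≤ Q :=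
    hQ _ (Subgroup.map_subtype_le _) (S.2.map _)
  have hS : Subgroup.normalizer (S : Set C) ≤ Subgroup.centralizer (S : Set C) :=
    fun c _ s hs => Subtype.ext (c.2 s (hSQ (Subgroup.mem_map_of_mem C.subtype hs)))
  calc C = ((S : Subgroup C) ⊔ pPrimeCore p C).map C.subtype := by
        rw [sup_pPrimeCore_eq_top_of_normalizer_le_centralizer S hS, ← MonoidHom.range_eq_map,
          Subgroup.range_subtype]
    _ ≤ Q ⊔ pPrimeCore p L := by
        rw [Subgroup.map_sup]
        exact sup_le_sup hSQ (map_subtype_pPrimeCore_le C)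

end Cores

section Model

theorem isPGroup_of_sylow_eq_range {p : ℕ} {S N : Type*} [Group S] [Group N] {κ : S →* N}
    (hκ : Function.Injective κ) (SN : Sylow p N) (hSN : (SN : Subgroup N) = κ.range) :
    IsPGroup p S :=
  (hSN ▸ SN.2 : IsPGroup p κ.range).of_injective κ.rangeRestrict
    (κ.rangeRestrict_injective_iff.2 hκ)

/-- `R` acts on `K` by `x • k = γ x * k * (β x)⁻¹`, and a fixed point exists as `p ∤ |K|`. -/
theorem exists_conj_eq_of_mk_eq {p : ℕ} [Fact p.Prime] {R N : Type*} [Group R] [Group N]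
    (hR : IsPGroup p R) {K : Subgroup N} [K.Normal] (hK : p.Coprime (Nat.card K))
    {β γ : R →* N} (h : ∀ x, (β x : N ⧸ K) = γ x) : ∃ k ∈ K, ∀ x, γ x = k * β x * k⁻¹ := by
  have hmem (x : R) (k : K) : γ x * k * (β x)⁻¹ ∈ K := by
    rw [← QuotientGroup.eq_one_iff]
    simp [← h]
  let : MulAction R K :=
    { smul := fun x k => ⟨γ x * k * (β x)⁻¹, hmem x k⟩
      one_smul := fun k => Subtype.ext (show γ 1 * k * (β 1)⁻¹ = (k : N) by simp)
      mul_smul := fun x y k => Subtype.ext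
        (show γ (x * y) * k * (β (x * y))⁻¹ = γ x * (γ y * k * (β y)⁻¹) * (β x)⁻¹ by
          simp [mul_assoc]) }
  obtain ⟨k, hk⟩ := hR.nonempty_fixed_point_of_prime_not_dvd_card K
    ((Nat.Prime.coprime_iff_not_dvd Fact.out).1 hK)
  exact ⟨k, k.2, fun x =>
    eq_mul_inv_of_mul_eq (mul_inv_eq_iff_eq_mul.1 (congrArg Subtype.val (hk x)))⟩

theorem centralizer_map_mk'_le {N : Type*} [Group N] {Q K : Subgroup N} [Q.Normal] [K.Normal]
    (h : Disjoint Q K) :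
    Subgroup.centralizer (Q.map (QuotientGroup.mk' K) : Set (N ⧸ K)) ≤
      (Subgroup.centralizer (Q : Set N)).map (QuotientGroup.mk' K) := by
  intro l hl
  obtain ⟨n, rfl⟩ := QuotientGroup.mk'_surjective K l
  refine ⟨n, fun q hq => ?_, rfl⟩
  have hQ : q * n * q⁻¹ * n⁻¹ ∈ Q := by
    simpa [mul_assoc] using mul_mem hq ((inferInstance : Q.Normal).conj_mem _ (inv_mem hq) n)
  have hK : q * n * q⁻¹ * n⁻¹ ∈ K := by
    have hcomm := hl _ (Subgroup.mem_map_of_mem (QuotientGroup.mk' K) hq)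
    rw [← QuotientGroup.ker_mk' K, MonoidHom.mem_ker]
    simp only [map_mul, map_inv, hcomm, mul_inv_cancel_right, mul_inv_cancel]
  rw [← mul_inv_eq_iff_eq_mul]
  exact mul_inv_eq_one.1 (Subgroup.disjoint_def.1 h hQ hK)

namespace FusionSystem

variable {p : ℕ}

theorem ofEmbedding_mk'_comp [Fact p.Prime] {S N : Type*} [Group S] [Group N] (hS : IsPGroup p S)
    {κ : S →* N} (hκ : Function.Injective κ) {K : Subgroup N} [K.Normal]
    (hK : p.Coprime (Nat.card K)) (hι : Function.Injective ((QuotientGroup.mk' K).comp κ)) :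
    ofEmbedding ((QuotientGroup.mk' K).comp κ) hι = ofEmbedding κ hκ := by
  ext R T φ
  constructor
  · rintro ⟨l, hl⟩
    obtain ⟨n, rfl⟩ := QuotientGroup.mk'_surjective K l
    obtain ⟨k, -, hk⟩ := exists_conj_eq_of_mk_eq (hS.to_subgroup R) hK
      (β := (MulAut.conj n⁻¹).toMonoidHom.comp (κ.comp R.subtype))
      (γ := κ.comp (T.subtype.comp φ)) fun x => by simpa using (hl x).symm
    exact ⟨n * k⁻¹, fun x => (hk x).trans (by simp [mul_assoc])⟩
  · rintro ⟨n, hn⟩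
    exact ⟨QuotientGroup.mk' K n, fun x => by simp [hn x]⟩

theorem isModel_of_centralizer_le {S L : Type*} [Group S] [Group L] {ι : S →* L}
    (hι : Function.Injective ι) (SL : Sylow p L) (hSL : (SL : Subgroup L) = ι.range)
    {Q : Subgroup L} [hQn : Q.Normal] (hQ : IsPGroup p Q)
    (hc : Subgroup.centralizer (Q : Set L) ≤ Q) : IsModel p (ofEmbedding ι hι) L := by
  refine ⟨?_, eq_bot_iff.2 (sSup_le fun X hX => ?_), ι, hι, ⟨SL, hSL⟩, rfl⟩
  · exact (Subgroup.centralizer_le (SetLike.coe_subset_coe.2 (le_pCore hQ))).trans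
      (hc.trans (le_pCore hQ))
  · have hdisj : Disjoint X Q := IsPGroup.card.disjoint_of_coprime hQ hX.2
    have hXQ : X ≤ Q := fun x hx => hc fun q hq =>
      (Subgroup.commute_of_normal_of_disjoint _ _ hX.1 hQn hdisj x q hx hq).symm
    exact (disjoint_of_le_iff_left_eq_bot hXQ).1 hdisj |>.le

theorem isModel_quotient_pPrimeCore [Fact p.Prime] {S N : Type*} [Group S] [Group N] [Finite N]
    {κ : S →* N} (hκ : Function.Injective κ) (SN : Sylow p N)
    (hSN : (SN : Subgroup N) = κ.range) {Q : Subgroup N} [hQn : Q.Normal] (hQ : IsPGroup p Q)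
    (hcent : IsPCentric p Q) : IsModel p (ofEmbedding κ hκ) (N ⧸ pPrimeCore p N) := by
  let K := pPrimeCore p N
  let π := QuotientGroup.mk' K
  have hπ : Function.Surjective π := QuotientGroup.mk'_surjective K
  have hS : IsPGroup p S := isPGroup_of_sylow_eq_range hκ SN hSN
  have hdisj {X : Subgroup N} (hX : IsPGroup p X) : Disjoint X K :=
    hX.disjoint_of_coprime .card coprime_card_pPrimeCore
  have hι : Function.Injective (π.comp κ) := (injective_iff_map_eq_one _).2 fun s hs =>
    (map_eq_one_iff κ hκ).1 (Subgroup.disjoint_def.1 (hdisj SN.2) (hSN.ge ⟨s, rfl⟩)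
      ((QuotientGroup.eq_one_iff _).1 hs))
  have hc : Subgroup.centralizer (Q.map π : Set (N ⧸ K)) ≤ Q.map π :=
    calc _ ≤ (Subgroup.centralizer (Q : Set N)).map π := centralizer_map_mk'_le (hdisj hQ)
      _ ≤ (Q ⊔ K).map π := Subgroup.map_mono hcent.centralizer_le_sup_pPrimeCore
      _ = Q.map π := by
        rw [Subgroup.map_sup, QuotientGroup.map_mk'_self, sup_bot_eq]
  have := hQn.map π hπ
  rw [← ofEmbedding_mk'_comp hS hκ coprime_card_pPrimeCore hι]
  exact isModel_of_centralizer_le hι (SN.mapSurjective hπ)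
    (by rw [Sylow.coe_mapSurjective, hSN, MonoidHom.range_comp]) (hQ.map π) hc

end FusionSystem

end Model

section KernelElt

namespace compatible

variable {T Γ V X : Type*} [Group T] [Group Γ] [Group V] [Group X] {φ : X →* MulAut V}
  {j : T →* Γ} {f : T →* V} (hj : Function.Injective j)

include hj

theorem elt_prod_act_injective : Function.Injective ((elt φ j f).prod (act φ j f)) :=
  (injective_iff_map_eq_one _).2 fun m hm => by
    obtain ⟨helt, hact⟩ := Prod.ext_iff.1 hm
    have haut : aut φ j f m = 1 := MulEquiv.ext fun t => by
      simp [aut_apply_of_elt_eq hj (t := 1) (by simpa using helt)]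
    exact Subtype.ext (Prod.ext haut (Prod.ext helt hact))

theorem act_comp_ker_elt_injective :
    Function.Injective ((act φ j f).comp (elt φ j f).ker.subtype) := fun m n h =>
  Subtype.ext (elt_prod_act_injective hj (Prod.ext (m.2.trans n.2.symm) h))

variable {g : T →* X}

theorem map_act_ker_elt_le :
    (elt MulAut.conj j g).ker.map (act MulAut.conj j g) ≤
      Subgroup.centralizer (g.range : Set X) := by
  rintro _ ⟨m, hm, rfl⟩ _ ⟨t, rfl⟩
  have hmt := map_aut_right m t
  rw [aut_apply_of_elt_eq hj (t := 1) (by simpa using hm)] at hmt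
  simpa [eq_mul_inv_iff_mul_eq] using hmt

variable (hc : Subgroup.centralizer (g.range : Set X) ≤ g.range)

include hc

theorem isMulCommutative_ker_elt : IsMulCommutative (elt MulAut.conj j g).ker := by
  refine ⟨⟨fun m n => act_comp_ker_elt_injective hj ?_⟩⟩
  simp only [map_mul]
  exact map_act_ker_elt_le hj ⟨n, n.2, rfl⟩ _ (hc (map_act_ker_elt_le hj ⟨m, m.2, rfl⟩))

theorem isPGroup_ker_elt {p : ℕ} (hT : IsPGroup p T) : IsPGroup p (elt MulAut.conj j g).ker :=
  .of_injective (hT.of_surjective _ g.rangeRestrict_surjective)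
    (((act MulAut.conj j g).comp (elt MulAut.conj j g).ker.subtype).codRestrict g.range
      fun m => hc (map_act_ker_elt_le hj ⟨m, m.2, rfl⟩))
    ((MonoidHom.injective_codRestrict _ _ _).2 (act_comp_ker_elt_injective hj))

end compatible

end KernelElt

section Diagonal

namespace compatible

variable {S N L : Type*} [Group S] [Group N] [Group L] (Q : Subgroup S) [Q.Normal] (κ : S →* N)
  (ι : S →* L)

/-- The diagonal embedding of a common overgroup `S` of `Q` in `N` and `L`. -/
def diag : S →* compatible MulAut.conj (κ.comp Q.subtype) (ι.comp Q.subtype) :=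
  (MulAut.conjNormal.prod (κ.prod ι)).codRestrict _ fun s q => by simp

@[simp]
theorem act_diag (s : S) : act MulAut.conj _ _ (diag Q κ ι s) = ι s := rfl

variable {Q κ ι}

theorem normal_map_diag (hκ : Function.Injective κ) : (Q.map (diag Q κ ι)).Normal := by
  refine ⟨?_⟩
  rintro _ ⟨q, hq, rfl⟩ m
  have hj : Function.Injective (κ.comp Q.subtype) := hκ.comp Q.subtype_injective
  refine ⟨aut _ _ _ m ⟨q, hq⟩, (aut _ _ _ m ⟨q, hq⟩).2, elt_prod_act_injective hj ?_⟩
  exact Prod.ext (map_aut_left m ⟨q, hq⟩) (map_aut_right m ⟨q, hq⟩)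

theorem disjoint_ker_elt_range_diag (hκ : Function.Injective κ) :
    Disjoint (elt MulAut.conj (κ.comp Q.subtype) (ι.comp Q.subtype)).ker (diag Q κ ι).range := by
  refine Subgroup.disjoint_def.2 ?_
  rintro _ hs ⟨s, rfl⟩
  rw [(map_eq_one_iff κ hκ).1 hs, map_one]

theorem ker_elt_sup_range_diag :
    (elt MulAut.conj (κ.comp Q.subtype) (ι.comp Q.subtype)).ker ⊔ (diag Q κ ι).range =
      κ.range.comap (elt MulAut.conj (κ.comp Q.subtype) (ι.comp Q.subtype)) := by
  have hrange : (diag Q κ ι).range.map (elt MulAut.conj (κ.comp Q.subtype) (ι.comp Q.subtype)) =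
      κ.range := (MonoidHom.range_comp _ _).symm
  rw [← hrange, Subgroup.comap_map_eq, sup_comm]

theorem not_dvd_index_ker_elt_sup_range_diag [Finite N] {p : ℕ} [Fact p.Prime] (SN : Sylow p N)
    (hSN : (SN : Subgroup N) = κ.range) :
    ¬ p ∣ ((elt MulAut.conj (κ.comp Q.subtype) (ι.comp Q.subtype)).ker ⊔
      (diag Q κ ι).range).index := by
  rw [ker_elt_sup_range_diag, Subgroup.index_comap, ← hSN]
  refine fun hdvd => SN.not_dvd_index (hdvd.trans (Subgroup.relIndex_dvd_index_of_le ?_))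
  rw [hSN]
  rintro _ ⟨s, rfl⟩
  exact ⟨diag Q κ ι s, rfl⟩

end compatible

open compatible in
/-- In `compatible MulAut.conj κ|_Q ι|_Q` Gaschütz's theorem gives a complement `W` to the kernel
of the projection to `N` which contains the diagonal copy of `Q`. It embeds into `N`, and it maps
onto `L` as `C_L(Q) ≤ Q`. -/
theorem InducesAction.involves_of_centralizer_le {p : ℕ} [Fact p.Prime] {S N L : Type*} [Group S]
    [Group N] [Group L] [Finite N] [Finite L] {κ : S →* N} (hκ : Function.Injective κ)
    (SN : Sylow p N) (hSN : (SN : Subgroup N) = κ.range) {ι : S →* L} {Q : Subgroup S} [Q.Normal]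
    (hc : Subgroup.centralizer (Q.map ι : Set L) ≤ Q.map ι)
    (h : InducesAction (MulAut.conj : L →* MulAut L) (κ.comp Q.subtype) (ι.comp Q.subtype)) :
    Involves N L := by
  have hS : IsPGroup p S := isPGroup_of_sylow_eq_range hκ SN hSN
  have hj : Function.Injective (κ.comp Q.subtype) := hκ.comp Q.subtype_injective
  have hrange : (ι.comp Q.subtype).range = Q.map ι := by
    rw [MonoidHom.range_comp, Subgroup.range_subtype]
  rw [← hrange] at hc
  have := isMulCommutative_ker_elt hj hc
  have : Finite (compatible MulAut.conj (κ.comp Q.subtype) (ι.comp Q.subtype)) :=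
    .of_injective _ (elt_prod_act_injective hj)
  have hindex := (Nat.Prime.coprime_iff_not_dvd Fact.out).2
    (not_dvd_index_ker_elt_sup_range_diag (Q := Q) (ι := ι) SN hSN)
  obtain ⟨n, hn⟩ := IsPGroup.iff_card.1 (isPGroup_ker_elt hj hc (hS.to_subgroup Q))
  obtain ⟨W, hW, hKW⟩ := exists_isComplement'_of_disjoint_of_coprime_index _ _
    (disjoint_ker_elt_range_diag hκ) (hn ▸ hindex.pow_left n)
  have hQW : Q.map (diag Q κ ι) ≤ W :=
    have := normal_map_diag (ι := ι) (Q := Q) hκ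
    (Subgroup.normal_le_normalCore.2 (Subgroup.map_le_range _ _)).trans hKW
  refine .of_ker_le ((elt _ _ _).comp W.subtype) ((act _ _ _).comp W.subtype) (fun l => ?_)
    fun w hw => ?_
  · obtain ⟨m, rfl⟩ := h.act_surjective l
    obtain ⟨a, ha, w, hw, rfl⟩ := Subgroup.mem_sup_of_normal_left.1
      (hW.sup_eq_top.ge (Subgroup.mem_top m))
    obtain ⟨q, hq⟩ := hc (map_act_ker_elt_le hj ⟨a, ha, rfl⟩)
    exact ⟨⟨diag Q κ ι q * w, mul_mem (hQW ⟨q, q.2, rfl⟩) hw⟩, by simp [← hq]⟩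
  · have hw1 : (w : compatible MulAut.conj (κ.comp Q.subtype) (ι.comp Q.subtype)) = 1 :=
      Subgroup.disjoint_def.1 hW.disjoint hw w.2
    simp [hw1]

end Diagonal

section EqualFusion

theorem exists_hom_of_conj {S L : Type*} [Group S] [Group L] {ι : S →* L}
    (hι : Function.Injective ι) {R T : Subgroup S} (l : L)
    (h : ∀ x ∈ R, l⁻¹ * ι x * l ∈ T.map ι) : ∃ φ : R →* T, ∀ x, ι (φ x) = l⁻¹ * ι x * l := by
  choose f hf hfι using h
  exact ⟨MonoidHom.mk' (fun x => ⟨f x x.2, hf x x.2⟩) fun x y => Subtype.ext (hι (by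
    simp [hfι, mul_assoc])), fun x => hfι x x.2⟩

theorem exists_mulAut_of_mem_normalizer {S L : Type*} [Group S] [Group L] {ι : S →* L}
    (hι : Function.Injective ι) {Q : Subgroup S} {l : L}
    (hl : l ∈ Subgroup.normalizer (Q.map ι : Set L)) :
    ∃ α : MulAut Q, ∀ x, ι (α x) = l * ι x * l⁻¹ := by
  let e := Q.equivMapOfInjective ι hι
  refine ⟨(e.trans ((Q.map ι).normalizerMonoidHom ⟨l, hl⟩)).trans e.symm, fun x => ?_⟩
  rw [← Subgroup.coe_equivMapOfInjective_apply Q ι hι]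
  exact congrArg Subtype.val (e.apply_symm_apply _)

theorem exists_map_conj_le_sylow {p : ℕ} [Fact p.Prime] {G : Type*} [Group G] [Finite G]
    {X : Subgroup G} (hX : IsPGroup p X) (P : Sylow p G) :
    ∃ g : G, X.map (MulAut.conj g).toMonoidHom ≤ P := by
  obtain ⟨P', hP'⟩ := hX.exists_le_sylow
  obtain ⟨g, rfl⟩ := MulAction.exists_smul_eq G P' P
  exact ⟨g, Subgroup.map_mono hP'⟩

theorem IsPCentric.map_of_sylow {p : ℕ} {S L : Type*} [Group S] [Group L] [Finite L]
    [Fact p.Prime] {ι : S →* L} (hι : Function.Injective ι) (SL : Sylow p L)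
    (hSL : (SL : Subgroup L) = ι.range) {Q : Subgroup S} [hQ : (Q.map ι).Normal]
    (hc : Subgroup.centralizer (Q : Set S) ≤ Q) : IsPCentric p (Q.map ι) := by
  intro R hR hRp x hx
  obtain ⟨g, hg⟩ := exists_map_conj_le_sylow hRp SL
  obtain ⟨s, hs : ι s = g * x * g⁻¹⟩ := hSL.le (hg (Subgroup.mem_map_of_mem _ hx))
  suffices hsQ : s ∈ Q by
    simpa [hs, mul_assoc] using hQ.conj_mem _ (Subgroup.mem_map_of_mem ι hsQ) g⁻¹
  refine hc fun q hq => hι ?_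
  have hsC : ι s ∈ Subgroup.centralizer (Q.map ι : Set L) := by
    have : (Subgroup.centralizer (Q.map ι : Set L)).Normal := Subgroup.normal_centralizer
    simpa [hs] using this.conj_mem x (hR hx) g
  simpa using hsC _ ⟨q, hq, rfl⟩

namespace FusionSystem

variable {S : Type u} {L N : Type*} [Group S] [Group L] [Group N] {ι : S →* L} {κ : S →* N}
  {hι : Function.Injective ι} {hκ : Function.Injective κ}
  (hF : ofEmbedding ι hι = ofEmbedding κ hκ)

include hF

theorem exists_conj_of_ofEmbedding_eq (R : Subgroup S) (l : L)
    (h : ∀ x ∈ R, l⁻¹ * ι x * l ∈ ι.range) :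
    ∃ (φ : R →* S) (n : N), ∀ x, ι (φ x) = l⁻¹ * ι x * l ∧ κ (φ x) = n⁻¹ * κ x * n := by
  obtain ⟨φ, hφ⟩ := exists_hom_of_conj hι (T := ⊤) l (by rwa [← MonoidHom.range_eq_map])
  have hmem : φ ∈ (ofEmbedding ι hι).Hom R ⊤ := ⟨l, hφ⟩
  rw [hF] at hmem
  obtain ⟨n, hn⟩ := hmem
  exact ⟨Subgroup.subtype ⊤ |>.comp φ, n, fun x => ⟨hφ x, hn x⟩⟩

theorem inducesAction_of_ofEmbedding_eq {Q : Subgroup S} [(Q.map ι).Normal] :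
    InducesAction (MulAut.conj : L →* MulAut L) (κ.comp Q.subtype) (ι.comp Q.subtype) := by
  intro l
  obtain ⟨α, hα⟩ := exists_mulAut_of_mem_normalizer hι (Q := Q) (l := l)
    (Subgroup.normalizer_eq_top (Q.map ι) ▸ Subgroup.mem_top l)
  have hmem : α.toMonoidHom ∈ (ofEmbedding ι hι).Hom Q Q := ⟨l⁻¹, fun x => by simpa using hα x⟩
  rw [hF] at hmem
  obtain ⟨n, hn⟩ := hmem
  exact ⟨α, n⁻¹, fun x => ⟨by simpa using hn x, hα x⟩⟩

variable {p : ℕ} (SL : Sylow p L) (hSL : (SL : Subgroup L) = ι.range)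
  (hL : Subgroup.centralizer (pCore p L : Set L) ≤ pCore p L) {Q : Subgroup S}
  [hQ : (Q.map κ).Normal]

include hSL hL hQ

/-- Transporting conjugation by `l` on `O_p(L)` to `N` gives `n`, and transporting conjugation by
`n` on `O_p(L) Q` back to `L` gives `m`. As `l` and `m` agree on `O_p(L)`, they differ by an
element of `C_L(O_p(L)) ≤ O_p(L)`. -/
theorem exists_mul_eq_of_ofEmbedding_eq (l : L) :
    ∃ (s : S) (m : L) (n : N), ι s * m = l ∧
      ∀ x ∈ Q, ∃ y, ι y = m⁻¹ * ι x * m ∧ κ y = n⁻¹ * κ x * n := by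
  have hcore : pCore p L ≤ ι.range := hSL ▸ pCore_le_sylow SL
  let R := (pCore p L).comap ι
  obtain ⟨φ, n, hφ⟩ := exists_conj_of_ofEmbedding_eq hF R l fun x hx =>
    hcore (by simpa using (normal_pCore (p := p)).conj_mem (ι x) hx l⁻¹)
  have hle : R ⊔ Q ≤ κ.range.comap ((MulAut.conj n⁻¹).toMonoidHom.comp κ) := by
    refine sup_le (fun x hx => ⟨φ ⟨x, hx⟩, by simp [(hφ _).2]⟩) fun x hx => ?_
    exact Subgroup.map_le_range _ _ (hQ.conj_mem _ (Subgroup.mem_map_of_mem κ hx) n⁻¹)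
  obtain ⟨ψ, m, hψ⟩ := exists_conj_of_ofEmbedding_eq hF.symm (R ⊔ Q) n fun x hx => by
    simpa using hle hx
  have hlm : l * m⁻¹ ∈ pCore p L := hL fun x hx => by
    obtain ⟨x, rfl⟩ := hcore hx
    have hφψ : ψ ⟨x, Subgroup.mem_sup_left hx⟩ = φ ⟨x, hx⟩ :=
      hκ ((hψ _).1.trans (hφ ⟨x, hx⟩).2.symm)
    have hml : m⁻¹ * ι x * m = l⁻¹ * ι x * l := by
      rw [← (hφ ⟨x, hx⟩).1, ← hφψ, (hψ _).2]
    calc ι x * (l * m⁻¹) = l * (l⁻¹ * ι x * l) * m⁻¹ := by group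
      _ = l * m⁻¹ * ι x := by rw [← hml]; group
  obtain ⟨s, hs⟩ := hcore hlm
  exact ⟨s, m, n, by simp [hs], fun x hx => ⟨_, (hψ ⟨x, Subgroup.mem_sup_right hx⟩).symm⟩⟩

theorem normal_map_of_ofEmbedding_eq : (Q.map ι).Normal := by
  have hQκ : (Q.map κ).comap κ = Q := Subgroup.comap_map_eq_self_of_injective hκ Q
  have hQS : Q.Normal := hQκ ▸ hQ.comap κ
  refine ⟨?_⟩
  rintro _ ⟨q, hq, rfl⟩ l
  obtain ⟨s, m, n, hl, hmn⟩ := exists_mul_eq_of_ofEmbedding_eq (Q := Q) hF SL hSL hL l⁻¹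
  obtain ⟨y, hyι, hyκ⟩ := hmn _ (hQS.conj_mem q hq s⁻¹)
  have hy : y ∈ Q := by
    rw [← hQκ, Subgroup.mem_comap, hyκ]
    simpa using hQ.conj_mem _ (Subgroup.mem_map_of_mem κ (hQS.conj_mem q hq s⁻¹)) n⁻¹
  refine ⟨y, hy, ?_⟩
  rw [hyι, ← inv_inv l, ← hl]
  simp [mul_assoc]

theorem involves_of_ofEmbedding_eq [Finite L] [Finite N] [Fact p.Prime] (SN : Sylow p N)
    (hSN : (SN : Subgroup N) = κ.range) (hL' : pPrimeCore p L = ⊥)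
    (hc : Subgroup.centralizer (Q : Set S) ≤ Q) : Involves N L := by
  have : Q.Normal := Subgroup.comap_map_eq_self_of_injective hκ Q ▸ hQ.comap κ
  have := normal_map_of_ofEmbedding_eq hF SL hSL hL (Q := Q)
  have hcQ := (IsPCentric.map_of_sylow hι SL hSL hc).centralizer_le_sup_pPrimeCore
  rw [hL', sup_bot_eq] at hcQ
  exact (inducesAction_of_ofEmbedding_eq hF).involves_of_centralizer_le hκ SN hSN hcQ

end FusionSystem

end EqualFusion

section Centric

variable {p : ℕ} {S G : Type*} [Group S] [Group G] {Q : Subgroup G}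

theorem IsPCentric.centralizer_le (hG : IsPGroup p G) (h : IsPCentric p Q) :
    Subgroup.centralizer (Q : Set G) ≤ Q :=
  h _ le_rfl (hG.to_subgroup _)

theorem IsPCentric.comap (h : IsPCentric p Q) {ι : S →* G} (hQ : Q ≤ ι.range) :
    IsPCentric p (Q.comap ι) := fun R hR hRp => by
  refine Subgroup.map_le_iff_le_comap.1 (h _ ?_ (hRp.map ι))
  rintro _ ⟨x, hx, rfl⟩ q hq
  obtain ⟨y, rfl⟩ := hQ hq
  simpa using congrArg ι (hR hx y hq)

theorem IsPCentric.map_conj (h : IsPCentric p Q) (g : G) :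
    IsPCentric p (Q.map (MulAut.conj g).toMonoidHom) := by
  rw [Subgroup.map_equiv_eq_comap_symm']
  exact h.comap fun q _ => (MulAut.conj g).symm.surjective q

end Centric

section Normaliser

namespace FusionSystem

variable {P : Type u} {G : Type*} [Group P] [Group G] (ι : P →* G) (Q : Subgroup P)

/-- The homomorphism `N_P(Q) → N_G(Q)` induced by `ι : P →* G`. -/
def normalizerEmbedding :
    Subgroup.normalizer (Q : Set P) →* Subgroup.normalizer (Q.map ι : Set G) :=
  (ι.comp (Subgroup.normalizer (Q : Set P)).subtype).codRestrict _ fun x =>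
    Subgroup.le_normalizer_map ι ⟨x, x.2, rfl⟩

theorem map_normalizerEmbedding_subgroupOf :
    (Q.subgroupOf (Subgroup.normalizer (Q : Set P))).map (normalizerEmbedding ι Q) =
      (Q.map ι).subgroupOf (Subgroup.normalizer (Q.map ι : Set G)) := by
  ext n
  constructor
  · rintro ⟨x, hx, rfl⟩
    exact ⟨x, hx, rfl⟩
  · rintro ⟨x, hx, hxn⟩
    exact ⟨⟨x, Subgroup.le_normalizer hx⟩, hx, Subtype.ext hxn⟩

variable {ι} (hι : Function.Injective ι)

include hι in
theorem normalizerEmbedding_injective : Function.Injective (normalizerEmbedding ι Q) :=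
  (MonoidHom.injective_codRestrict _ _ _).2 (hι.comp (Subgroup.subtype_injective _))

variable {Q}

theorem map_image {R : Subgroup P} {φ : Q →* R} {g : G} (hφ : ∀ x, ι (φ x) = g⁻¹ * ι x * g) :
    (image φ).map ι = (Q.map ι).map (MulAut.conj g⁻¹).toMonoidHom := by
  have hcomp : (ι.comp R.subtype).comp φ =
      ((MulAut.conj g⁻¹).toMonoidHom.comp ι).comp Q.subtype := by
    ext x
    simp [hφ]
  rw [image, Subgroup.map_map, ← MonoidHom.range_comp, hcomp, MonoidHom.range_comp,
    Subgroup.range_subtype, Subgroup.map_map]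

theorem mem_normalizer_of_mulEquiv {α : Q ≃* Q} {g : G} (hα : ∀ x, ι (α x) = g⁻¹ * ι x * g) :
    g ∈ Subgroup.normalizer (Q.map ι : Set G) := by
  refine Subgroup.mem_normalizer_iff''.2 fun h => ⟨?_, ?_⟩
  · rintro ⟨x, hx, rfl⟩
    exact ⟨α ⟨x, hx⟩, (α _).2, hα _⟩
  · rintro ⟨x, hx, hxh⟩
    refine ⟨α.symm ⟨x, hx⟩, (α.symm _).2, ?_⟩
    have hsymm := hα (α.symm ⟨x, hx⟩)
    rw [α.apply_symm_apply, hxh] at hsymm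
    exact (mul_left_cancel (mul_right_cancel hsymm)).symm

variable {hι} {R T : Subgroup (Subgroup.normalizer (Q : Set P))} {φ : R →* T}

theorem mem_hom_normalizerEmbedding_of_isExtension {φ' : mulNorm Q R →* mulNorm Q T}
    (h : (ofEmbedding ι hι).IsExtension Q φ φ') :
    φ ∈ (ofEmbedding _ (normalizerEmbedding_injective Q hι)).Hom R T := by
  obtain ⟨⟨g, hg⟩, hφ, α, -, hα⟩ := h
  have hgN : g ∈ Subgroup.normalizer (Q.map ι : Set G) :=
    mem_normalizer_of_mulEquiv (α := α) fun x => by rw [← hα, hg]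
  refine ⟨⟨g, hgN⟩, fun x => Subtype.ext ?_⟩
  have hx := hg ⟨x, mulNorm_left x⟩
  rwa [hφ] at hx

theorem exists_isExtension
    (h : φ ∈ (ofEmbedding _ (normalizerEmbedding_injective Q hι)).Hom R T) :
    ∃ φ', (ofEmbedding ι hι).IsExtension Q φ φ' := by
  obtain ⟨⟨n, hn⟩, hφ⟩ := h
  replace hφ (x : R) : ι (φ x : Subgroup.normalizer (Q : Set P)) =
      n⁻¹ * ι (x : Subgroup.normalizer (Q : Set P)) * n := congrArg Subtype.val (hφ x)
  obtain ⟨α, hα⟩ := exists_mulAut_of_mem_normalizer hι (inv_mem hn)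
  rw [inv_inv] at hα
  have hle : mulNorm Q R ≤
      ((mulNorm Q T).map ι).comap ((MulAut.conj n⁻¹).toMonoidHom.comp ι) := by
    refine sup_le ?_ fun x hx => ⟨_, mulNorm_right (α ⟨x, hx⟩), by simpa using hα ⟨x, hx⟩⟩
    rintro _ ⟨x, hx, rfl⟩
    exact ⟨_, mulNorm_left (φ ⟨x, hx⟩), by simpa using hφ ⟨x, hx⟩⟩
  obtain ⟨φ', hφ'⟩ := exists_hom_of_conj hι n fun x hx => by simpa using hle hx
  exact ⟨φ', ⟨n, hφ'⟩, fun x => hι ((hφ' _).trans (hφ x).symm), α, ⟨n, hα⟩,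
    fun x => hι ((hφ' _).trans (hα x).symm)⟩

theorem normaliser_ofEmbedding :
    (ofEmbedding ι hι).normaliser Q = ofEmbedding _ (normalizerEmbedding_injective Q hι) := by
  ext R T φ
  exact ⟨fun ⟨_, h⟩ => mem_hom_normalizerEmbedding_of_isExtension h, exists_isExtension⟩

theorem IsCentric.centralizer_le {F : FusionSystem P} (h : F.IsCentric Q) :
    Subgroup.centralizer (Q : Set P) ≤ Q := by
  have hid : image (MonoidHom.id Q) = Q := by
    rw [image, MonoidHom.range_eq_top_of_surjective (MonoidHom.id Q) Function.surjective_id,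
      ← MonoidHom.range_eq_map, Subgroup.range_subtype]
  simpa only [hid] using h Q _ (F.id_mem Q)

theorem isCentric_of_isPCentric {p : ℕ} (hP : IsPGroup p P) (h : IsPCentric p (Q.map ι)) :
    (ofEmbedding ι hι).IsCentric Q := by
  rintro R φ ⟨g, hg⟩
  have himage : IsPCentric p ((image φ).map ι) := map_image hg ▸ h.map_conj g⁻¹
  rw [← Subgroup.comap_map_eq_self_of_injective hι (image φ)]
  exact (himage.comap (Subgroup.map_le_range _ _)).centralizer_le hP

theorem card_normalizer_map_conj (H : Subgroup G) (g : G) :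
    Nat.card (Subgroup.normalizer (H.map (MulAut.conj g).toMonoidHom : Set G)) =
      Nat.card (Subgroup.normalizer (H : Set G)) := by
  have h := Subgroup.map_equiv_normalizer_eq H (MulAut.conj g)
  exact (congrArg (fun K : Subgroup G => Nat.card K) h).symm.trans
    (Subgroup.card_map_of_injective (MulAut.conj g).injective)

end FusionSystem

end Normaliser

section FullyNormalised

namespace FusionSystem

variable {p : ℕ} [Fact p.Prime] {P : Type u} {G : Type*} [Group P] [Group G] [Finite G]
  {ι : P →* G} (hι : Function.Injective ι) {Q : Subgroup P}

include hι in
theorem card_normalizer_le (hP : IsPGroup p P) (Q : Subgroup P) :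
    Nat.card (Subgroup.normalizer (Q : Set P)) ≤
      ordProj[p] (Nat.card (Subgroup.normalizer (Q.map ι : Set G))) := by
  obtain ⟨S, hS⟩ := ((hP.to_subgroup (Subgroup.normalizer (Q : Set P))).of_surjective _
    (normalizerEmbedding ι Q).rangeRestrict_surjective).exists_le_sylow
  rw [← S.card_eq_multiplicity,
    Nat.card_congr (MonoidHom.ofInjective (normalizerEmbedding_injective Q hι)).toEquiv]
  exact Subgroup.card_le_of_le hS

include hι in
theorem exists_sylow_eq_range_normalizerEmbedding
    (h : Nat.card (Subgroup.normalizer (Q : Set P)) =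
      ordProj[p] (Nat.card (Subgroup.normalizer (Q.map ι : Set G)))) :
    ∃ S : Sylow p (Subgroup.normalizer (Q.map ι : Set G)),
      (S : Subgroup _) = (normalizerEmbedding ι Q).range :=
  ⟨.ofCard _ ((Nat.card_congr
    (MonoidHom.ofInjective (normalizerEmbedding_injective Q hι)).toEquiv).symm.trans h), rfl⟩

variable (SP : Sylow p G) (hSP : (SP : Subgroup G) = ι.range)

include hι hSP

theorem exists_map_eq_map_conj {Q₀ : Subgroup G} (hQ₀ : IsPGroup p Q₀) :
    ∃ (g : G) (Q : Subgroup P), Q.map ι = Q₀.map (MulAut.conj g).toMonoidHom ∧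
      Nat.card (Subgroup.normalizer (Q : Set P)) =
        ordProj[p] (Nat.card (Subgroup.normalizer (Q.map ι : Set G))) := by
  have hP : IsPGroup p P := isPGroup_of_sylow_eq_range hι SP hSP
  let N₀ := Subgroup.normalizer (Q₀ : Set G)
  let S₀ : Sylow p N₀ := default
  let X := (S₀ : Subgroup N₀).map N₀.subtype
  have hQX : Q₀ ≤ X := by
    have hp : IsPGroup p (Q₀.subgroupOf N₀) := hQ₀.comap_subtype
    have : (Q₀.subgroupOf N₀).Normal := Subgroup.normal_in_normalizer
    rw [← Subgroup.map_subgroupOf_eq_of_le (Subgroup.le_normalizer : Q₀ ≤ N₀)]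
    exact Subgroup.map_mono (hp.le_sylow_of_normal S₀)
  obtain ⟨g, hg⟩ := exists_map_conj_le_sylow (S₀.2.map N₀.subtype) SP
  let Q₁ := Q₀.map (MulAut.conj g).toMonoidHom
  have hQ₁ : Q₁ ≤ ι.range := ((Subgroup.map_mono hQX).trans hg).trans_eq hSP
  have hQ : (Q₁.comap ι).map ι = Q₁ := Subgroup.map_comap_eq_self hQ₁
  have hX : X.map (MulAut.conj g).toMonoidHom ≤
      (Subgroup.normalizer (Q₁.comap ι : Set P)).map ι := by
    rw [← Subgroup.comap_normalizer_eq_of_le_range hQ₁, Subgroup.map_comap_eq]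
    refine le_inf (hg.trans_eq hSP) ?_
    exact (Subgroup.map_mono (Subgroup.map_subtype_le _)).trans (Subgroup.le_normalizer_map _)
  refine ⟨g, Q₁.comap ι, hQ, (card_normalizer_le hι hP _).antisymm ?_⟩
  calc _ = Nat.card S₀ := by rw [hQ, card_normalizer_map_conj, S₀.card_eq_multiplicity]
    _ = Nat.card (X.map (MulAut.conj g).toMonoidHom) := by
      rw [Subgroup.card_map_of_injective (MulAut.conj g).injective,
        Subgroup.card_map_of_injective N₀.subtype_injective]
    _ ≤ Nat.card ((Subgroup.normalizer (Q₁.comap ι : Set P)).map ι) := Subgroup.card_le_of_le hX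
    _ = _ := Subgroup.card_map_of_injective hι

theorem isFullyNormalised_iff : (ofEmbedding ι hι).IsFullyNormalised Q ↔
    Nat.card (Subgroup.normalizer (Q : Set P)) =
      ordProj[p] (Nat.card (Subgroup.normalizer (Q.map ι : Set G))) := by
  have hP : IsPGroup p P := isPGroup_of_sylow_eq_range hι SP hSP
  refine ⟨fun h => (card_normalizer_le hι hP Q).antisymm ?_, ?_⟩
  · obtain ⟨g, Q', hQ', hcard⟩ := exists_map_eq_map_conj hι SP hSP ((hP.to_subgroup Q).map ι)
    obtain ⟨φ, hφ⟩ := exists_hom_of_conj hι (R := Q) (T := Q') g⁻¹ fun x hx => by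
      rw [hQ']
      exact ⟨ι x, ⟨x, hx, rfl⟩, by simp⟩
    have himage : image φ = Q' :=
      Subgroup.map_injective hι ((map_image hφ).trans (by rw [hQ', inv_inv]))
    calc _ = Nat.card (Subgroup.normalizer (Q' : Set P)) := by
          rw [hcard, hQ', card_normalizer_map_conj]
      _ ≤ _ := himage ▸ h Q' φ ⟨g⁻¹, hφ⟩
  · rintro h R φ ⟨g, hg⟩
    rw [h, ← card_normalizer_map_conj _ g⁻¹, ← map_image hg]
    exact card_normalizer_le hι hP _

end FusionSystem

end FullyNormalised

section Models

theorem Involves.normalizer_map_conj {G X : Type*} [Group G] [Group X] {H : Subgroup G}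
    (h : Involves (Subgroup.normalizer (H : Set G)) X) (g : G) :
    Involves (Subgroup.normalizer (H.map (MulAut.conj g).toMonoidHom : Set G)) X := by
  rw [← Subgroup.map_equiv_normalizer_eq]
  exact (Involves.of_surjective (f := (Subgroup.equivMapOfInjective _ _
    (MulAut.conj g).injective).symm.toMonoidHom) (MulEquiv.surjective _)).trans h

namespace FusionSystem

variable {p : ℕ} [Fact p.Prime] {P G : Type u} [Group P] [Group G] [Finite G] {ι : P →* G}
  {hι : Function.Injective ι} (SP : Sylow p G) (hSP : (SP : Subgroup G) = ι.range)

include hSP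

theorem involves_of_isModel_normaliser {Q : Subgroup P} (hc : (ofEmbedding ι hι).IsCentric Q)
    (hn : (ofEmbedding ι hι).IsFullyNormalised Q) {L : Type*} [Group L] [Finite L]
    (hL : IsModel p ((ofEmbedding ι hι).normaliser Q) L) : Involves G L := by
  obtain ⟨hcore, hcore', ιL, hιL, ⟨SL, hSL⟩, hF⟩ := hL
  rw [normaliser_ofEmbedding] at hF
  obtain ⟨SN, hSN⟩ := exists_sylow_eq_range_normalizerEmbedding hι
    ((isFullyNormalised_iff hι SP hSP).1 hn)
  have : ((Q.subgroupOf (Subgroup.normalizer (Q : Set P))).map (normalizerEmbedding ι Q)).Normal :=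
    map_normalizerEmbedding_subgroupOf ι Q ▸ Subgroup.normal_in_normalizer
  have hcQ : Subgroup.centralizer (Q.subgroupOf (Subgroup.normalizer (Q : Set P)) : Set _) ≤
      Q.subgroupOf (Subgroup.normalizer (Q : Set P)) := fun x hx =>
    hc.centralizer_le fun q hq => congrArg Subtype.val (hx ⟨q, Subgroup.le_normalizer hq⟩ hq)
  exact (involves_of_ofEmbedding_eq hF.symm SL hSL hcore SN hSN hcore' hcQ).of_subgroup

theorem exists_isModel_normaliser_of_involves (hp : p ≠ 2) (h : Involves G (Qd p)) :
    ∃ Q : Subgroup P, (ofEmbedding ι hι).IsCentric Q ∧ (ofEmbedding ι hι).IsFullyNormalised Q ∧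
      ∃ (L : Type u) (_ : Group L) (_ : Finite L),
        IsModel p ((ofEmbedding ι hι).normaliser Q) L ∧ Involves L (Qd p) := by
  obtain ⟨Q₀, hQ₀, hc₀, hinv₀⟩ := Involves.exists_isPCentric hp h
  obtain ⟨g, Q, hQ, hcard⟩ := exists_map_eq_map_conj hι SP hSP hQ₀
  have hP : IsPGroup p P := isPGroup_of_sylow_eq_range hι SP hSP
  have hc : IsPCentric p (Q.map ι) := hQ ▸ hc₀.map_conj g
  have hinv : Involves (Subgroup.normalizer (Q.map ι : Set G)) (Qd p) :=
    hQ ▸ hinv₀.normalizer_map_conj g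
  let N := Subgroup.normalizer (Q.map ι : Set G)
  obtain ⟨SN, hSN⟩ := exists_sylow_eq_range_normalizerEmbedding hι hcard
  have : ((Q.map ι).subgroupOf N).Normal := Subgroup.normal_in_normalizer
  have hcN : IsPCentric p ((Q.map ι).subgroupOf N) :=
    hc.comap (Subgroup.le_normalizer.trans_eq N.range_subtype.symm)
  have hpN : IsPGroup p ((Q.map ι).subgroupOf N) := ((hP.to_subgroup Q).map ι).comap_subtype
  refine ⟨Q, isCentric_of_isPCentric hP hc, (isFullyNormalised_iff hι SP hSP).2 hcard,
    N ⧸ pPrimeCore p N, inferInstance, inferInstance, ?_,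
    hinv.quotient_of_coprime hp coprime_card_pPrimeCore⟩
  rw [normaliser_ofEmbedding]
  exact isModel_quotient_pPrimeCore (normalizerEmbedding_injective Q hι) SN hSN hpN hcN

end FusionSystem

end Models

theorem mainTheorem3 (p : ℕ) [Fact p.Prime] (hp : p ≠ 2) (G : Type u) [Group G] [Finite G]
    (P : Sylow p G) :
    (FusionSystem.ofGroup (P : Subgroup G)).IsQdFree p ↔ ¬ Involves G (Qd p) := by
  have hP : (P : Subgroup G) = (P : Subgroup G).subtype.range := (Subgroup.range_subtype _).symm
  constructor
  · intro hfree hG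
    obtain ⟨Q, hc, hn, L, _, _, hL, hLQ⟩ :=
      FusionSystem.exists_isModel_normaliser_of_involves P hP hp hG
    exact hfree Q hc hn L hL hLQ
  · intro hG Q hc hn L _ _ hL hLQ
    exact hG ((FusionSystem.involves_of_isModel_normaliser P hP hc hn hL).trans hLQ)
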